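/- Let $d\ge 0$ and let $(m,\sigma)$ be a $C^3$ curve on $[0,1]$ with $m_t\in\mathbb{R}^d$ and $\sigma_t\in\mathbb{R}^{d\times d}$ diagonal and positive definite for every $t\in[0,1]$, and let $\mu_t=\mathcal N(m_t,\sigma_t^2)$ be the Gaussian measure on $\mathbb{R}^d$ with mean $m_t$ and covariance matrix $\sigma_t^2$. For a probability measure $\mu$ on $\mathbb{R}^d$ let $T_\mu$ be the closure in $L^2(\mu;\mathbb{R}^d)$ of $\{\nabla\varphi:\varphi\in C_c^\infty(\mathbb{R}^d)\}$. Call a Borel field $v:(0,1)\times\mathbb{R}^d\to\mathbb{R}^d$ *admissible* for $(\mu_t)_t$ if $v_t\in T_{\mu_t}$ for almost every $t\in(0,1)$, $v$ is locally integrable on $(0,1)\times\mathbb{R}^d$ with respect to $\mu_t\,dt$, and the continuity equation $\partial_t\mu_t+\nabla\cdot(v_t\mu_t)=0$ holds in the sense of distributions, i.e. $\int_0^1\int_{\mathbb{R}^d}\big(\partial_t\phi+\langle v_t,\nabla\phi\rangle\big)\,d\mu_t\,dt=0$ for all $\phi\in C_c^\infty((0,1)\times\mathbb{R}^d)$. The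 continuous path energy and the continuous spline energy are $$\mathcal E((\mu_t)_t)=\inf_{v\text{ admissible}}\int_0^1\!\int_{\mathbb{R}^d}|v_t|^2\,d\mu_t\,dt,\qquad \mathcal F((\mu_t)_t)=\inf_{v\text{ admissible}}\int_0^1\!\int_{\mathbb{R}^d}\big|\partial_t v_t+\tfrac12\nabla|v_t|^2\big|^2\,d\mu_t\,dt,$$ where the second infimum runs over the admissible $v$ such that $v$ and $|v|^2$ are locally (Lebesgue) integrable on $(0,1)\times\mathbb{R}^d$ and the distribution $\partial_t v+\tfrac12\nabla|v|^2$ on $(0,1)\times\mathbb{R}^d$ is a locally integrable function. Both infima take values in $[0,\infty]$. Then $$\mathcal E((\mu_t)_t)=\int_0^1\|\dot\sigma_t\|_F^2\,dt+\int_0^1|\dot m_t|^2\,dt,\qquad \mathcal F((\mu_t)_t)=\int_0^1\|\ddot\sigma_t\|_F^2\,dt+\int_0^1|\ddot m_t|^2\,dt,$$ where $\|A\|_F^2=\operatorname{tr}(A^TA)$. -/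

import Mathlib

open MeasureTheory Set
open scoped ContDiff Gradient RealInnerProductSpace Matrix.Norms.Frobenius

namespace WassersteinSpline

/-- `φ` is a real test function of `(t, x)` on the open strip `(0,1) × ℝ^d`: smooth, with compact
support contained in the strip. -/
def IsTestFunction {d : ℕ} (φ : ℝ × EuclideanSpace ℝ (Fin d) → ℝ) : Prop :=
  ContDiff ℝ ∞ φ ∧ HasCompactSupport φ ∧ tsupport φ ⊆ Ioo (0 : ℝ) 1 ×ˢ univ

/-- The tangent space `T_μ` of the Wasserstein space at `μ`: the closure in `L²(μ; ℝ^d)` of the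
gradients of smooth compactly supported functions. -/
def tangentSpace {d : ℕ} (μ : Measure (EuclideanSpace ℝ (Fin d))) :
    Set (Lp (EuclideanSpace ℝ (Fin d)) 2 μ) :=
  closure {f | ∃ φ : EuclideanSpace ℝ (Fin d) → ℝ,
    ContDiff ℝ ∞ φ ∧ HasCompactSupport φ ∧ f =ᵐ[μ] ∇ φ}

/-- The vector field `w` represents an element of `T_μ`. -/
def IsTangent {d : ℕ} (μ : Measure (EuclideanSpace ℝ (Fin d)))
    (w : EuclideanSpace ℝ (Fin d) → EuclideanSpace ℝ (Fin d)) : Prop :=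
  ∃ f ∈ tangentSpace μ, f =ᵐ[μ] w

/-- The pair `(μ_t, v_t)` solves the continuity equation `∂ₜμ + ∇·(v μ) = 0` on `(0,1) × ℝ^d` in
the sense of distributions. The second field says that `v` is locally integrable on
`(0,1) × ℝ^d` with respect to `μ_t dt`, so that the equation makes sense. -/
structure SolvesCE {d : ℕ} (μ : ℝ → Measure (EuclideanSpace ℝ (Fin d)))
    (v : ℝ → EuclideanSpace ℝ (Fin d) → EuclideanSpace ℝ (Fin d)) : Prop where
  measurable : Measurable (Function.uncurry v)
  locally_integrable : ∀ a b R : ℝ, 0 < a → b < 1 →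
    ∫⁻ t in Icc a b, ∫⁻ x in Metric.closedBall 0 R, ‖v t x‖ₑ ∂(μ t) < ⊤
  equation : ∀ φ : ℝ × EuclideanSpace ℝ (Fin d) → ℝ, IsTestFunction φ →
    ∫ t in Ioo (0 : ℝ) 1, ∫ x,
      (deriv (fun s => φ (s, x)) t + ⟪v t x, ∇ (fun y => φ (t, y)) x⟫) ∂(μ t) = 0

/-- The admissible velocity fields `v_t ∈ T_{μ_t} ∩ CE((μ_t)_t)`. -/
def Admissible {d : ℕ} (μ : ℝ → Measure (EuclideanSpace ℝ (Fin d)))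
    (v : ℝ → EuclideanSpace ℝ (Fin d) → EuclideanSpace ℝ (Fin d)) : Prop :=
  SolvesCE μ v ∧ ∀ᵐ t ∂(volume.restrict (Ioo (0 : ℝ) 1)), IsTangent (μ t) (v t)

/-- The field `a` is `∂ₜv + ½ ∇|v|²` on `(0,1) × ℝ^d`, the derivatives being taken in the sense of
distributions: `v`, `|v|²` and `a` are locally integrable and, for every test function `φ`,
`∫∫ (∂ₜφ v + ½ |v|² ∇φ) dx dt = - ∫∫ φ a dx dt`. -/
structure IsAcceleration {d : ℕ}
    (v a : ℝ → EuclideanSpace ℝ (Fin d) → EuclideanSpace ℝ (Fin d)) : Prop where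
  measurable : Measurable (Function.uncurry a)
  velocity : LocallyIntegrableOn (fun p : ℝ × EuclideanSpace ℝ (Fin d) => v p.1 p.2)
    (Ioo (0 : ℝ) 1 ×ˢ univ)
  velocity_sq : LocallyIntegrableOn (fun p : ℝ × EuclideanSpace ℝ (Fin d) => ‖v p.1 p.2‖ ^ 2)
    (Ioo (0 : ℝ) 1 ×ˢ univ)
  acceleration : LocallyIntegrableOn (fun p : ℝ × EuclideanSpace ℝ (Fin d) => a p.1 p.2)
    (Ioo (0 : ℝ) 1 ×ˢ univ)
  equation : ∀ φ : ℝ × EuclideanSpace ℝ (Fin d) → ℝ, IsTestFunction φ →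
    ∫ p in Ioo (0 : ℝ) 1 ×ˢ (univ : Set (EuclideanSpace ℝ (Fin d))),
        (deriv (fun s => φ (s, p.2)) p.1 • v p.1 p.2
          + ((1 / 2 : ℝ) * ‖v p.1 p.2‖ ^ 2) • ∇ (fun y => φ (p.1, y)) p.2) =
      - ∫ p in Ioo (0 : ℝ) 1 ×ˢ (univ : Set (EuclideanSpace ℝ (Fin d))), φ p • a p.1 p.2

/-- The squared norm `∫₀¹ ∫ |w_t|² dμ_t dt` of a field along the curve `(μ_t)_t`. -/
noncomputable def actionIntegral {d : ℕ} (μ : ℝ → Measure (EuclideanSpace ℝ (Fin d)))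
    (w : ℝ → EuclideanSpace ℝ (Fin d) → EuclideanSpace ℝ (Fin d)) : ENNReal :=
  ∫⁻ t in Ioo (0 : ℝ) 1, ∫⁻ x, ‖w t x‖ₑ ^ 2 ∂(μ t)

/-- The continuous path energy `inf_v ∫₀¹ ∫ |v_t|² dμ_t dt` over the admissible velocity
fields. -/
noncomputable def pathEnergy {d : ℕ} (μ : ℝ → Measure (EuclideanSpace ℝ (Fin d))) : ENNReal :=
  ⨅ (v : ℝ → EuclideanSpace ℝ (Fin d) → EuclideanSpace ℝ (Fin d)) (_ : Admissible μ v),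
    actionIntegral μ v

/-- The continuous spline energy `inf_v ∫₀¹ ∫ |∂ₜv_t + ½ ∇|v_t|²|² dμ_t dt` over the admissible
velocity fields (for which `∂ₜv + ½ ∇|v|²` exists as a function). -/
noncomputable def splineEnergy {d : ℕ} (μ : ℝ → Measure (EuclideanSpace ℝ (Fin d))) : ENNReal :=
  ⨅ (v : ℝ → EuclideanSpace ℝ (Fin d) → EuclideanSpace ℝ (Fin d)) (_ : Admissible μ v)
    (a : ℝ → EuclideanSpace ℝ (Fin d) → EuclideanSpace ℝ (Fin d)) (_ : IsAcceleration v a),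
    actionIntegral μ a

end WassersteinSpline

/-! The affine maps `z ↦ m_t + σ_t z` carry the standard Gaussian to `μ_t`, because `σ_t` is the
positive square root of the covariance. The velocity of this flow in space coordinates is `v_t(x) =
ṁ_t + σ̇_t σ_t⁻¹ (x - m_t)`. Diagonality makes `σ̇_t σ_t⁻¹` symmetric, so `v_t` is the gradient of a
quadratic polynomial; its Gaussian moments are finite and cutoffs place it in the tangent space
(`isTangent_vel`). The chain rule along trajectories gives the continuity equation (`solvesCE_vel`).

Both infima are in fact taken over one class of fields. The difference of two admissible fields is,
for almost every time, orthogonal to all gradients of test functions while lying in the closure of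
those gradients, so it vanishes (`ae_eq_vel_of_admissible`). As `μ_t` and Lebesgue measure have the
same null sets, the distribution `∂ₜv + ½∇|v|²` is then determined as well
(`ae_eq_acc_of_isAcceleration`). It is the acceleration of the flow, since `½∇|v|² = (Dv)ᵀ v = (Dv)
v` when `Dv` is symmetric (`isAcceleration_acc`).

Along the flow, velocity and acceleration are `ṁ + σ̇ z` and `m̈ + σ̈ z`. For a standard Gaussian
`z` the mean of `|b + s z|²` is `|b|² + ‖s‖_F²`, and integrating in time yields both formulas
(`actionIntegral_affine`). -/

namespace WassersteinSpline

open ProbabilityTheory Filter Topology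

/-! ### Coordinatewise algebra: diagonal matrices treated as vectors. -/

section Hadamard

variable {d : ℕ}

/-- The coordinatewise product of two vectors. -/
noncomputable def had (a b : EuclideanSpace ℝ (Fin d)) : EuclideanSpace ℝ (Fin d) :=
  WithLp.toLp 2 (fun i => a i * b i)

@[simp] lemma had_apply (a b : EuclideanSpace ℝ (Fin d)) (i : Fin d) :
    had a b i = a i * b i := rfl

@[fun_prop]
lemma continuous_had {X : Type*} [TopologicalSpace X] {f g : X → EuclideanSpace ℝ (Fin d)}
    (hf : Continuous f) (hg : Continuous g) : Continuous (fun x => had (f x) (g x)) := by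
  refine (PiLp.continuous_toLp 2 _).comp (continuous_pi fun i => ?_)
  exact ((EuclideanSpace.proj (𝕜 := ℝ) i).continuous.comp hf).mul
    ((EuclideanSpace.proj (𝕜 := ℝ) i).continuous.comp hg)

/-- The coordinatewise inverse of a vector. -/
noncomputable def hinv (a : EuclideanSpace ℝ (Fin d)) : EuclideanSpace ℝ (Fin d) :=
  WithLp.toLp 2 (fun i => (a i)⁻¹)

@[simp] lemma hinv_apply (a : EuclideanSpace ℝ (Fin d)) (i : Fin d) :
    hinv a i = (a i)⁻¹ := rfl

lemma hasDerivAt_euclidean {f : ℝ → EuclideanSpace ℝ (Fin d)} {f' : EuclideanSpace ℝ (Fin d)}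
    {t : ℝ} : HasDerivAt f f' t ↔ ∀ i, HasDerivAt (fun s => f s i) (f' i) t := by
  have h := hasDerivAt_pi (φ := fun s => (f s).ofLp) (φ' := f'.ofLp) (x := t)
  rw [← h]
  constructor
  · intro hf
    exact ((PiLp.continuousLinearEquiv 2 ℝ (fun _ : Fin d => ℝ)).hasFDerivAt.comp_hasDerivAt t hf)
  · intro hf
    exact ((PiLp.continuousLinearEquiv 2 ℝ
      (fun _ : Fin d => ℝ)).symm.hasFDerivAt.comp_hasDerivAt t hf)

end Hadamard

/-! ### Diagonal affine flows, their velocity and their acceleration. -/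

/-- A curve of positive diagonal affine maps `z ↦ M t + S t ⊙ z` on `ℝ^d`, with continuous first
and second derivatives `M₁, S₁` and `M₂, S₂` on `(0,1)`, continuously extended to `ℝ`. -/
structure AffineCurve (d : ℕ) where
  (M M₁ M₂ S S₁ S₂ : ℝ → EuclideanSpace ℝ (Fin d))
  contM : Continuous M
  contM₁ : Continuous M₁
  contM₂ : Continuous M₂
  contS : Continuous S
  contS₁ : Continuous S₁
  contS₂ : Continuous S₂
  derivM : ∀ t ∈ Ioo (0 : ℝ) 1, HasDerivAt M (M₁ t) t
  derivM₁ : ∀ t ∈ Ioo (0 : ℝ) 1, HasDerivAt M₁ (M₂ t) t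
  derivS : ∀ t ∈ Ioo (0 : ℝ) 1, HasDerivAt S (S₁ t) t
  derivS₁ : ∀ t ∈ Ioo (0 : ℝ) 1, HasDerivAt S₁ (S₂ t) t
  pos : ∀ t i, 0 < S t i

namespace AffineCurve

variable {d : ℕ} (c : AffineCurve d)

attribute [fun_prop] contM contM₁ contM₂ contS contS₁ contS₂

/-- The affine map at time `t`. -/
noncomputable def flow (t : ℝ) (z : EuclideanSpace ℝ (Fin d)) : EuclideanSpace ℝ (Fin d) :=
  c.M t + had (c.S t) z

/-- The inverse of the affine map at time `t`. -/
noncomputable def back (t : ℝ) (x : EuclideanSpace ℝ (Fin d)) : EuclideanSpace ℝ (Fin d) :=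
  had (hinv (c.S t)) (x - c.M t)

/-- The velocity field of the flow. -/
noncomputable def vel (t : ℝ) (x : EuclideanSpace ℝ (Fin d)) : EuclideanSpace ℝ (Fin d) :=
  c.M₁ t + had (c.S₁ t) (c.back t x)

/-- The acceleration field of the flow. -/
noncomputable def acc (t : ℝ) (x : EuclideanSpace ℝ (Fin d)) : EuclideanSpace ℝ (Fin d) :=
  c.M₂ t + had (c.S₂ t) (c.back t x)

/-- The image of the standard Gaussian measure under the flow. -/
noncomputable def law (t : ℝ) : Measure (EuclideanSpace ℝ (Fin d)) :=
  (stdGaussian (EuclideanSpace ℝ (Fin d))).map (c.flow t)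

lemma S_ne (t : ℝ) (i : Fin d) : c.S t i ≠ 0 := (c.pos t i).ne'

@[simp] lemma back_flow (t : ℝ) (z : EuclideanSpace ℝ (Fin d)) : c.back t (c.flow t z) = z := by
  ext i
  have := c.S_ne t i
  simp [back, flow]
  field_simp

lemma vel_flow (t : ℝ) (z : EuclideanSpace ℝ (Fin d)) :
    c.vel t (c.flow t z) = c.M₁ t + had (c.S₁ t) z := by simp [vel]

lemma acc_flow (t : ℝ) (z : EuclideanSpace ℝ (Fin d)) :
    c.acc t (c.flow t z) = c.M₂ t + had (c.S₂ t) z := by simp [acc]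

lemma continuous_flow_uncurry : Continuous (Function.uncurry c.flow) := by
  unfold Function.uncurry flow
  fun_prop

lemma continuous_flow (t : ℝ) : Continuous (c.flow t) := by
  unfold flow
  fun_prop

lemma continuous_hinv : Continuous (fun t => hinv (c.S t)) := by
  refine (PiLp.continuous_toLp 2 _).comp (continuous_pi fun i => ?_)
  exact ((EuclideanSpace.proj (𝕜 := ℝ) i).continuous.comp c.contS).inv₀ fun t => c.S_ne t i

lemma continuous_back : Continuous (Function.uncurry c.back) := by
  exact continuous_had (c.continuous_hinv.comp continuous_fst)
    (continuous_snd.sub (c.contM.comp continuous_fst))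

lemma continuous_vel : Continuous (Function.uncurry c.vel) := by
  have : Continuous (fun p : ℝ × EuclideanSpace ℝ (Fin d) => c.back p.1 p.2) := c.continuous_back
  unfold Function.uncurry vel
  fun_prop

lemma continuous_acc : Continuous (Function.uncurry c.acc) := by
  have : Continuous (fun p : ℝ × EuclideanSpace ℝ (Fin d) => c.back p.1 p.2) := c.continuous_back
  unfold Function.uncurry acc
  fun_prop

instance (t : ℝ) : IsProbabilityMeasure (c.law t) :=
  Measure.isProbabilityMeasure_map (c.continuous_flow t).aemeasurable

lemma hasDerivAt_flow {t : ℝ} (ht : t ∈ Ioo (0 : ℝ) 1) (z : EuclideanSpace ℝ (Fin d)) :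
    HasDerivAt (fun s => c.flow s z) (c.vel t (c.flow t z)) t := by
  rw [vel_flow, hasDerivAt_euclidean]
  intro i
  exact (hasDerivAt_euclidean.1 (c.derivM t ht) i).add
    ((hasDerivAt_euclidean.1 (c.derivS t ht) i).mul_const _)

end AffineCurve

/-! ### Second moments of affine images of the standard Gaussian. -/

lemma integral_norm_sq_affine_stdGaussian {d : ℕ} (b s : EuclideanSpace ℝ (Fin d)) :
    Integrable (fun z => ‖b + had s z‖ ^ 2) (stdGaussian (EuclideanSpace ℝ (Fin d))) ∧
    ∫ z, ‖b + had s z‖ ^ 2 ∂(stdGaussian (EuclideanSpace ℝ (Fin d))) = ‖b‖ ^ 2 + ‖s‖ ^ 2 := by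
  have h1 (i : Fin d) : MemLp (fun z : EuclideanSpace ℝ (Fin d) => z i) 2
      (stdGaussian (EuclideanSpace ℝ (Fin d))) := by
    exact (EuclideanSpace.proj (𝕜 := ℝ) i).comp_memLp' IsGaussian.memLp_two_id
  have h0 (i : Fin d) : ∫ z : EuclideanSpace ℝ (Fin d), z i
      ∂(stdGaussian (EuclideanSpace ℝ (Fin d))) = 0 :=
    integral_strongDual_stdGaussian (EuclideanSpace.proj (𝕜 := ℝ) i)
  have h2 (i : Fin d) : ∫ z : EuclideanSpace ℝ (Fin d), z i ^ 2
      ∂(stdGaussian (EuclideanSpace ℝ (Fin d))) = 1 := by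
    rw [← multivariateGaussian_zero_one]
    have h := variance_eval_multivariateGaussian (μ := (0 : EuclideanSpace ℝ (Fin d)))
      (S := 1) Matrix.PosSemidef.one i
    rw [variance_of_integral_eq_zero] at h
    · simpa using h
    · exact Measurable.aemeasurable (by fun_prop)
    · rw [multivariateGaussian_zero_one]; exact h0 i
  have key (i : Fin d) : Integrable (fun z : EuclideanSpace ℝ (Fin d) => (b + had s z) i ^ 2)
      (stdGaussian (EuclideanSpace ℝ (Fin d))) :=
    (((memLp_const (b i)).add ((h1 i).const_mul (s i)))).integrable_sq
  simp_rw [EuclideanSpace.real_norm_sq_eq]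
  refine ⟨integrable_finsetSum _ fun i _ => key i, ?_⟩
  rw [integral_finsetSum _ fun i _ => key i, ← Finset.sum_add_distrib]
  -- In each coordinate the cross term dies because the mean is zero, and the quadratic term keeps
  -- weight one because the variance is one.
  refine Finset.sum_congr rfl fun i _ => ?_
  have e : (fun z : EuclideanSpace ℝ (Fin d) => (b + had s z) i ^ 2) =
      fun z => b i ^ 2 + (2 * b i * s i) * z i + s i ^ 2 * z i ^ 2 := by
    ext z; simp; ring
  have i1 := ((h1 i).integrable (by norm_num)).const_mul (2 * b i * s i)
  have i2 := (h1 i).integrable_sq.const_mul (s i ^ 2)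
  have i3 : Integrable (fun z : EuclideanSpace ℝ (Fin d) => b i ^ 2 + (2 * b i * s i) * z i)
      (stdGaussian (EuclideanSpace ℝ (Fin d))) := (integrable_const _).add i1
  rw [e, integral_add i3 i2, integral_add (integrable_const _) i1,
    integral_const_mul, integral_const_mul, h0, h2]
  simp

lemma lintegral_norm_sq_affine_stdGaussian {d : ℕ} (b s : EuclideanSpace ℝ (Fin d)) :
    ∫⁻ z, ‖b + had s z‖ₑ ^ 2 ∂(stdGaussian (EuclideanSpace ℝ (Fin d))) =
      ENNReal.ofReal (‖b‖ ^ 2 + ‖s‖ ^ 2) := by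
  obtain ⟨h1, h2⟩ := integral_norm_sq_affine_stdGaussian b s
  rw [← h2, ofReal_integral_eq_lintegral_ofReal h1 (ae_of_all _ fun z => by positivity)]
  refine lintegral_congr fun z => ?_
  rw [ENNReal.ofReal_pow (norm_nonneg _), ofReal_norm]

/-- Pulling `law t` back to the standard Gaussian turns the action of a field that is affine along
the flow into the second moment above. It evaluates both energies. -/
lemma actionIntegral_affine {d : ℕ} (c : AffineCurve d)
    {w : ℝ → EuclideanSpace ℝ (Fin d) → EuclideanSpace ℝ (Fin d)}
    {b s : ℝ → EuclideanSpace ℝ (Fin d)} (hb : Continuous b) (hs : Continuous s)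
    (hw : Continuous (Function.uncurry w))
    (h : ∀ t z, w t (c.flow t z) = b t + had (s t) z) :
    actionIntegral c.law w =
      ENNReal.ofReal ((∫ t in (0 : ℝ)..1, ‖s t‖ ^ 2) + ∫ t in (0 : ℝ)..1, ‖b t‖ ^ 2) := by
  have h1 (t : ℝ) : ∫⁻ x, ‖w t x‖ₑ ^ 2 ∂(c.law t) = ENNReal.ofReal (‖s t‖ ^ 2 + ‖b t‖ ^ 2) := by
    rw [AffineCurve.law, lintegral_map _ (c.continuous_flow t).measurable]
    · simp_rw [h]
      rw [lintegral_norm_sq_affine_stdGaussian, add_comm]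
    · have : Continuous (w t) := hw.comp (Continuous.prodMk_right t)
      exact this.measurable.enorm.pow_const 2
  unfold actionIntegral
  simp_rw [h1]
  have is : IntervalIntegrable (fun t => ‖s t‖ ^ 2) volume 0 1 :=
    (hs.norm.pow 2).intervalIntegrable _ _
  have ib : IntervalIntegrable (fun t => ‖b t‖ ^ 2) volume 0 1 :=
    (hb.norm.pow 2).intervalIntegrable _ _
  rw [← intervalIntegral.integral_add is ib, intervalIntegral.integral_of_le zero_le_one,
    restrict_Ioo_eq_restrict_Ioc]
  exact (ofReal_integral_eq_lintegral_ofReal (is.add ib).1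
    (ae_of_all _ fun z => by positivity)).symm

/-! ### Equivalence of the Gaussian laws with Lebesgue measure. -/

lemma absolutelyContinuous_pi {n : ℕ} (μ ν : Fin n → Measure ℝ) [∀ i, SigmaFinite (μ i)]
    [∀ i, SigmaFinite (ν i)] (h : ∀ i, μ i ≪ ν i) : Measure.pi μ ≪ Measure.pi ν := by
  induction n with
  | zero => rw [Measure.pi_of_empty μ, Measure.pi_of_empty ν]
  | succ n ih =>
    have hμ := (measurePreserving_piFinSuccAbove μ 0).symm
    have hν := (measurePreserving_piFinSuccAbove ν 0).symm
    rw [← hμ.map_eq, ← hν.map_eq]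
    exact ((h 0).prod (ih _ _ fun j => h _)).map hμ.measurable

namespace AffineCurve

variable {d : ℕ} (c : AffineCurve d)

/-- A diagonal affine map acts on each coordinate separately, so the law is a product of
nondegenerate one-dimensional Gaussians. This reduces absolute continuity, in both directions, to
dimension one. -/
lemma law_eq_map_pi (t : ℝ) : c.law t =
    (Measure.pi fun i => gaussianReal (c.M t i) (⟨c.S t i ^ 2, sq_nonneg _⟩)).map
      (WithLp.toLp 2) := by
  have h : (fun i => gaussianReal (c.M t i) (⟨c.S t i ^ 2, sq_nonneg _⟩)) =
      fun i => (gaussianReal 0 1).map (fun z => c.M t i + c.S t i * z) := by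
    ext1 i
    have : (fun z => c.M t i + c.S t i * z) = (fun z => c.M t i + z) ∘ (fun z => c.S t i * z) := rfl
    rw [this, ← Measure.map_map (by fun_prop) (by fun_prop), gaussianReal_map_const_mul,
      gaussianReal_map_const_add]
    congr 1
    · simp
    · ext; simp; rfl
  have hp (i : Fin d) : IsProbabilityMeasure
      ((gaussianReal 0 1).map (fun z => c.M t i + c.S t i * z)) :=
    Measure.isProbabilityMeasure_map (by fun_prop)
  rw [h, ← Measure.pi_map_pi (fun i => by fun_prop), law, ← map_pi_eq_stdGaussian,
    Measure.map_map (c.continuous_flow t).measurable (by fun_prop),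
    Measure.map_map (by fun_prop) (by fun_prop)]
  rfl

lemma volume_eq_map_pi : (volume : Measure (EuclideanSpace ℝ (Fin d))) =
    (Measure.pi fun _ => volume).map (WithLp.toLp 2) :=
  (PiLp.volume_preserving_toLp (Fin d)).map_eq.symm

lemma law_absolutelyContinuous (t : ℝ) : c.law t ≪ volume := by
  rw [law_eq_map_pi, volume_eq_map_pi]
  refine (absolutelyContinuous_pi _ _ fun i => gaussianReal_absolutelyContinuous _ ?_).map
    (by fun_prop)
  exact fun h => pow_ne_zero 2 (c.S_ne t i) (congrArg NNReal.toReal h)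

lemma volume_absolutelyContinuous (t : ℝ) : volume ≪ c.law t := by
  rw [law_eq_map_pi, volume_eq_map_pi]
  refine (absolutelyContinuous_pi _ _ fun i => gaussianReal_absolutelyContinuous' _ ?_).map
    (by fun_prop)
  exact fun h => pow_ne_zero 2 (c.S_ne t i) (congrArg NNReal.toReal h)

lemma ae_law_iff (t : ℝ) {p : EuclideanSpace ℝ (Fin d) → Prop} :
    (∀ᵐ x ∂(c.law t), p x) ↔ ∀ᵐ x, p x :=
  ⟨fun h => (c.volume_absolutelyContinuous t).ae_le h,
    fun h => (c.law_absolutelyContinuous t).ae_le h⟩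

/-- Admissibility determines fields almost everywhere for `μ_t dt`, while distributional derivatives
see them almost everywhere for Lebesgue measure on the strip. This is the passage between the two.
-/
lemma ae_ae_law_iff {p : ℝ × EuclideanSpace ℝ (Fin d) → Prop} (hp : MeasurableSet {q | p q}) :
    (∀ᵐ t ∂(volume.restrict (Ioo (0 : ℝ) 1)), ∀ᵐ x ∂(c.law t), p (t, x)) ↔
      ∀ᵐ q ∂(volume.restrict (Ioo (0 : ℝ) 1 ×ˢ (univ : Set (EuclideanSpace ℝ (Fin d))))), p q := by
  simp_rw [ae_law_iff]
  rw [Measure.volume_eq_prod, ← Measure.prod_restrict, Measure.restrict_univ,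
    Measure.ae_prod_iff_ae_ae hp]

lemma actionIntegral_congr {v w : ℝ → EuclideanSpace ℝ (Fin d) → EuclideanSpace ℝ (Fin d)}
    (h : ∀ᵐ t ∂(volume.restrict (Ioo (0 : ℝ) 1)), ∀ᵐ x ∂(c.law t), v t x = w t x) :
    actionIntegral c.law v = actionIntegral c.law w := by
  refine lintegral_congr_ae ?_
  filter_upwards [h] with t ht
  refine lintegral_congr_ae ?_
  filter_upwards [ht] with x hx
  rw [hx]

end AffineCurve

/-! ### Cutoffs, and tangency of gradients of square integrable functions. -/

section Gradient

variable {d : ℕ}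

lemma norm_gradient (φ : EuclideanSpace ℝ (Fin d) → ℝ) (x : EuclideanSpace ℝ (Fin d)) :
    ‖∇ φ x‖ = ‖fderiv ℝ φ x‖ := by
  rw [gradient, LinearIsometryEquiv.norm_map]

lemma continuous_gradient {φ : EuclideanSpace ℝ (Fin d) → ℝ} (hφ : ContDiff ℝ ∞ φ) :
    Continuous (∇ φ) :=
  (InnerProductSpace.toDual ℝ _).symm.continuous.comp (hφ.continuous_fderiv (by simp))

lemma hasCompactSupport_gradient {φ : EuclideanSpace ℝ (Fin d) → ℝ} (hφ : HasCompactSupport φ) :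
    HasCompactSupport (∇ φ) :=
  (hφ.fderiv ℝ).comp_left (g := (InnerProductSpace.toDual ℝ (EuclideanSpace ℝ (Fin d))).symm)
    (map_zero _)

/-- Cutoff functions: smooth with compact support, at most `1`, equal to `1` near any given point
from some index on, with uniformly bounded derivatives. -/
lemma exists_cutoff (d : ℕ) : ∃ (χ : ℕ → EuclideanSpace ℝ (Fin d) → ℝ) (C : ℝ),
    (∀ n, ContDiff ℝ ∞ (χ n)) ∧ (∀ n, HasCompactSupport (χ n)) ∧ (∀ n x, |χ n x| ≤ 1) ∧
    (∀ n x, ‖fderiv ℝ (χ n) x‖ ≤ C) ∧ ∀ x, ∀ᶠ n in atTop, χ n =ᶠ[𝓝 x] 1 := by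
  let f : ContDiffBump (0 : EuclideanSpace ℝ (Fin d)) := ⟨1, 2, one_pos, by norm_num⟩
  have hf : ContDiff ℝ ∞ f := f.contDiff
  obtain ⟨C, hC⟩ := (hf.continuous_fderiv (by simp)).bounded_above_of_compact_support
    (f.hasCompactSupport.fderiv ℝ)
  have hpos (n : ℕ) : (0 : ℝ) < ((n : ℝ) + 1)⁻¹ := by positivity
  -- Dilating the bump by `n + 1 ≥ 1` divides its derivative by that factor, so the bound `C` for
  -- the original bump serves every `n`.
  refine ⟨fun n x => f (((n : ℝ) + 1)⁻¹ • x), C, fun n => hf.comp (contDiff_const_smul _),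
    fun n => f.hasCompactSupport.comp_smul (hpos n).ne', fun n x => ?_, fun n x => ?_,
    fun x => ?_⟩
  · rw [abs_of_nonneg f.nonneg]
    exact f.le_one
  · have h := fderiv_comp_smul (𝕜 := ℝ) (f := f) (((n : ℝ) + 1)⁻¹) (x := x)
    rw [h, norm_smul, Real.norm_of_nonneg (hpos n).le]
    have h1 : ((n : ℝ) + 1)⁻¹ ≤ 1 := inv_le_one_of_one_le₀ (by linarith [n.cast_nonneg (α := ℝ)])
    calc _ ≤ 1 * ‖fderiv ℝ f (((n : ℝ) + 1)⁻¹ • x)‖ := by gcongr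
      _ ≤ C := by rw [one_mul]; exact hC _
  · obtain ⟨N, hN⟩ := exists_nat_gt ‖x‖
    filter_upwards [eventually_ge_atTop N] with n hn
    have hx : ((n : ℝ) + 1)⁻¹ • x ∈ Metric.ball (0 : EuclideanSpace ℝ (Fin d)) 1 := by
      have : (N : ℝ) ≤ n := by exact_mod_cast hn
      rw [mem_ball_zero_iff, norm_smul, Real.norm_of_nonneg (hpos n).le,
        inv_mul_lt_one₀ (by positivity)]
      linarith
    have hc : Continuous fun y : EuclideanSpace ℝ (Fin d) => ((n : ℝ) + 1)⁻¹ • y := by fun_prop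
    exact hc.continuousAt.eventually (f.eventuallyEq_one_of_mem_ball hx)

lemma tendsto_eLpNorm_of_dominated {α F : Type*} {mα : MeasurableSpace α} {μ : Measure α}
    [NormedAddCommGroup F] {f : ℕ → α → F} {g : α → ℝ} (hf : ∀ n, AEStronglyMeasurable (f n) μ)
    (hg : MemLp g 2 μ) (h : ∀ n x, ‖f n x‖ ≤ g x)
    (h0 : ∀ x, Tendsto (fun n => f n x) atTop (𝓝 0)) :
    Tendsto (fun n => eLpNorm (f n) 2 μ) atTop (𝓝 0) := by
  have key : Tendsto (fun n => ∫⁻ x, ‖f n x‖ₑ ^ (2 : ℝ) ∂μ) atTop (𝓝 (∫⁻ _, 0 ∂μ)) := by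
    refine tendsto_lintegral_of_dominated_convergence' (fun x => ‖g x‖ₑ ^ (2 : ℝ))
      (fun n => (hf n).enorm.pow_const _) (fun n => ae_of_all _ fun x => ?_) ?_
      (ae_of_all _ fun x => ?_)
    · have : ‖f n x‖ₑ ≤ ‖g x‖ₑ :=
        enorm_le_iff_norm_le.2 ((h n x).trans (le_abs_self _))
      exact ENNReal.rpow_le_rpow this (by norm_num)
    · have := (eLpNorm_lt_top_iff_lintegral_rpow_enorm_lt_top (by norm_num) (by norm_num)).1
        hg.eLpNorm_lt_top
      simpa using this.ne
    · have h1 := (ENNReal.continuous_rpow_const (y := 2)).tendsto 0 |>.comp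
        ((continuous_enorm.tendsto (0 : F)).comp (h0 x) |>.trans (by simp))
      simpa [Function.comp_def] using h1
  have h2 := ((ENNReal.continuous_rpow_const (y := 1 / 2)).tendsto _).comp key
  simp only [lintegral_zero] at h2
  rw [ENNReal.zero_rpow_of_pos (by norm_num)] at h2
  refine h2.congr fun n => ?_
  rw [eLpNorm_eq_lintegral_rpow_enorm_toReal (by norm_num) (by norm_num)]
  simp

/-- The gradient of a smooth function is tangent as soon as the function and its gradient are
square integrable. -/
lemma isTangent_gradient {μ : Measure (EuclideanSpace ℝ (Fin d))}
    {φ : EuclideanSpace ℝ (Fin d) → ℝ} (hφ : ContDiff ℝ ∞ φ) (h0 : MemLp φ 2 μ)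
    (h1 : MemLp (∇ φ) 2 μ) : IsTangent μ (∇ φ) := by
  obtain ⟨χ, C, hχ, hcs, hle, hC, hev⟩ := exists_cutoff d
  have hprod (n : ℕ) : ContDiff ℝ ∞ (fun x => χ n x * φ x) := (hχ n).mul hφ
  have hbound (n : ℕ) (x : EuclideanSpace ℝ (Fin d)) :
      ‖∇ (fun x => χ n x * φ x) x‖ ≤ ‖∇ φ x‖ + C * ‖φ x‖ := by
    have e := fderiv_fun_mul ((hχ n).differentiable (by simp) x) (hφ.differentiable (by simp) x)
    rw [norm_gradient, norm_gradient, e]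
    refine (norm_add_le _ _).trans ?_
    rw [norm_smul, norm_smul, mul_comm C]
    have := hle n x
    have := hC n x
    gcongr
    rw [Real.norm_eq_abs]
    exact mul_le_of_le_one_left (norm_nonneg _) (hle n x)
  have hB : MemLp (fun x => ‖∇ φ x‖ + C * ‖φ x‖) 2 μ := h1.norm.add (h0.norm.const_mul C)
  have hmem (n : ℕ) : MemLp (∇ fun x => χ n x * φ x) 2 μ :=
    hB.mono' (continuous_gradient (hprod n)).aestronglyMeasurable (ae_of_all _ (hbound n))
  refine ⟨h1.toLp, ?_, h1.coeFn_toLp⟩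
  refine mem_closure_of_tendsto (f := fun n => (hmem n).toLp) (b := atTop) ?_
    (Eventually.of_forall fun n => ⟨_, hprod n, (hcs n).mul_right, (hmem n).coeFn_toLp⟩)
  rw [Lp.tendsto_Lp_iff_tendsto_eLpNorm'']
  refine tendsto_eLpNorm_of_dominated (g := fun x => (‖∇ φ x‖ + C * ‖φ x‖) + ‖∇ φ x‖)
    (fun n => (hmem n).1.sub h1.1) (hB.add h1.norm)
    (fun n x => (norm_sub_le _ _).trans (by gcongr; exact hbound n x)) fun x => ?_
  -- For fixed `x` the difference is exactly zero from some index on, since the cutoff is `1` on a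
  -- neighbourhood of `x`.
  refine tendsto_const_nhds.congr' ?_
  filter_upwards [hev x] with n hn
  have : (fun x => χ n x * φ x) =ᶠ[𝓝 x] φ := by
    filter_upwards [hn] with y hy
    rw [hy, Pi.one_apply, one_mul]
  rw [Pi.sub_apply, this.gradient_eq, sub_self]

end Gradient

/-! ### The velocity as the gradient of a quadratic potential. -/

namespace AffineCurve

variable {d : ℕ} (c : AffineCurve d)

/-- A potential of the velocity field. -/
noncomputable def pot (t : ℝ) (x : EuclideanSpace ℝ (Fin d)) : ℝ :=
  ∑ i, (c.M₁ t i * x i + c.S₁ t i * (c.S t i)⁻¹ * (x i - c.M t i) ^ 2 / 2)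

lemma contDiff_pot (t : ℝ) : ContDiff ℝ ∞ (c.pot t) := by
  unfold pot
  fun_prop

lemma gradient_pot (t : ℝ) : ∇ (c.pot t) = c.vel t := by
  ext1 x
  refine HasGradientAt.gradient ?_
  rw [hasGradientAt_iff_hasFDerivAt]
  have hp (i : Fin d) : HasFDerivAt (fun y : EuclideanSpace ℝ (Fin d) => y i)
      (EuclideanSpace.proj (𝕜 := ℝ) i) x := (EuclideanSpace.proj (𝕜 := ℝ) i).hasFDerivAt
  have h (i : Fin d) := ((hp i).const_mul (c.M₁ t i)).add
    (((((hp i).sub_const (c.M t i)).pow 2).const_mul (c.S₁ t i * (c.S t i)⁻¹)).mul_const (2⁻¹))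
  refine (HasFDerivAt.fun_sum (u := Finset.univ) fun i _ => h i).congr_fderiv ?_
  ext y
  simp [vel, back, PiLp.inner_apply]
  rw [← Finset.sum_add_distrib]
  refine Finset.sum_congr rfl fun i _ => ?_
  ring

lemma memLp_coord (t : ℝ) (i : Fin d) (p : ENNReal) (hp : p ≠ ⊤) :
    MemLp (fun x : EuclideanSpace ℝ (Fin d) => x i) p (c.law t) := by
  rw [law, memLp_map_measure_iff (by fun_prop) (c.continuous_flow t).aemeasurable]
  exact (memLp_const (c.M t i)).add
    (((EuclideanSpace.proj (𝕜 := ℝ) i).comp_memLp' (IsGaussian.memLp_id _ p hp)).const_mul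
      (c.S t i))

/-- The potential is quadratic, so its square integrability comes from fourth moments of the
Gaussian. -/
lemma memLp_pot (t : ℝ) : MemLp (c.pot t) 2 (c.law t) := by
  refine memLp_finsetSum _ fun i _ => ?_
  refine ((c.memLp_coord t i 2 (by simp)).const_mul _).add ?_
  have h4 : MemLp (fun x : EuclideanSpace ℝ (Fin d) => x i - c.M t i) 4 (c.law t) :=
    (c.memLp_coord t i 4 (by simp)).sub (memLp_const _)
  have h2 : MemLp (fun x : EuclideanSpace ℝ (Fin d) => (x i - c.M t i) ^ 2) 2 (c.law t) := by
    rw [memLp_two_iff_integrable_sq (by fun_prop)]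
    have := MemLp.integrable_norm_pow (p := 4) (by exact_mod_cast h4) (by simp)
    refine this.congr (ae_of_all _ fun x => ?_)
    simp only [Real.norm_eq_abs]
    rw [← pow_mul, Even.pow_abs (by decide)]
  have := h2.const_mul (c.S₁ t i * (c.S t i)⁻¹ / 2)
  refine this.congr_norm (by fun_prop) (ae_of_all _ fun x => ?_)
  congr 1
  ring

lemma memLp_vel (t : ℝ) : MemLp (c.vel t) 2 (c.law t) := by
  have hc : Continuous (c.vel t) := c.continuous_vel.comp (Continuous.prodMk_right t)
  rw [law, memLp_map_measure_iff hc.aestronglyMeasurable (c.continuous_flow t).aemeasurable,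
    memLp_two_iff_integrable_sq_norm
      (hc.comp (c.continuous_flow t)).aestronglyMeasurable]
  refine (integral_norm_sq_affine_stdGaussian (c.M₁ t) (c.S₁ t)).1.congr (ae_of_all _ fun z => ?_)
  simp only [Function.comp, vel_flow]

lemma isTangent_vel (t : ℝ) : IsTangent (c.law t) (c.vel t) := by
  rw [← c.gradient_pot t]
  refine isTangent_gradient (c.contDiff_pot t) (c.memLp_pot t) ?_
  rw [c.gradient_pot t]
  exact c.memLp_vel t

end AffineCurve

/-! ### Space-time test functions and their partial derivatives. -/

section TestFunctions

variable {d : ℕ}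

/-- The spatial gradient of a function of `(t, x)`. -/
noncomputable def gradSnd (φ : ℝ × EuclideanSpace ℝ (Fin d) → ℝ)
    (p : ℝ × EuclideanSpace ℝ (Fin d)) : EuclideanSpace ℝ (Fin d) :=
  (InnerProductSpace.toDual ℝ _).symm
    ((fderiv ℝ φ p).comp (ContinuousLinearMap.inr ℝ ℝ (EuclideanSpace ℝ (Fin d))))

lemma gradient_snd_eq {φ : ℝ × EuclideanSpace ℝ (Fin d) → ℝ} (hφ : Differentiable ℝ φ) (t : ℝ)
    (x : EuclideanSpace ℝ (Fin d)) : ∇ (fun y => φ (t, y)) x = gradSnd φ (t, x) := by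
  rw [gradient, gradSnd]
  congr 1
  exact ((hφ (t, x)).hasFDerivAt.comp x (hasFDerivAt_prodMk_right t x)).fderiv

lemma deriv_fst_eq {φ : ℝ × EuclideanSpace ℝ (Fin d) → ℝ} (hφ : Differentiable ℝ φ) (t : ℝ)
    (x : EuclideanSpace ℝ (Fin d)) :
    deriv (fun s => φ (s, x)) t = fderiv ℝ φ (t, x) (1, 0) :=
  ((hφ (t, x)).hasFDerivAt.comp_hasDerivAt t
    ((hasDerivAt_id t).prodMk (hasDerivAt_const t x))).deriv

lemma inner_gradSnd (φ : ℝ × EuclideanSpace ℝ (Fin d) → ℝ) (p : ℝ × EuclideanSpace ℝ (Fin d))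
    (w : EuclideanSpace ℝ (Fin d)) : ⟪w, gradSnd φ p⟫ = fderiv ℝ φ p (0, w) := by
  rw [real_inner_comm, gradSnd, InnerProductSpace.toDual_symm_apply]
  simp

lemma isCompact_subset_Ioo {K : Set ℝ} (hK : IsCompact K) (h : K ⊆ Ioo 0 1) :
    ∃ a b : ℝ, 0 < a ∧ b < 1 ∧ K ⊆ Icc a b := by
  -- Adding the point `1 / 2` makes the set nonempty, so that it has a least and a greatest element
  -- even when `K` is empty.
  have hc : IsCompact (insert (1 / 2) K) := hK.insert _
  have hne : (insert (1 / 2) K).Nonempty := insert_nonempty _ _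
  have hs : insert (1 / 2) K ⊆ Ioo (0 : ℝ) 1 := insert_subset (by norm_num) h
  obtain ⟨a, ha⟩ := hc.exists_isLeast hne
  obtain ⟨b, hb⟩ := hc.exists_isGreatest hne
  exact ⟨a, b, (hs ha.1).1, (hs hb.1).2, fun t ht =>
    ⟨ha.2 (mem_insert_of_mem _ ht), hb.2 (mem_insert_of_mem _ ht)⟩⟩

namespace IsTestFunction

variable {φ : ℝ × EuclideanSpace ℝ (Fin d) → ℝ}

lemma differentiable (hφ : IsTestFunction φ) : Differentiable ℝ φ := hφ.1.differentiable (by simp)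

lemma continuous_fderiv (hφ : IsTestFunction φ) : Continuous (fderiv ℝ φ) := hφ.1.continuous_fderiv (by simp)

lemma continuous_gradSnd (hφ : IsTestFunction φ) : Continuous (gradSnd φ) :=
  (InnerProductSpace.toDual ℝ _).symm.continuous.comp
    (hφ.continuous_fderiv.clm_comp continuous_const)

lemma fderiv_eq_zero_of_notMem {p : ℝ × EuclideanSpace ℝ (Fin d)} (hp : p ∉ tsupport φ) :
    fderiv ℝ φ p = 0 := by
  by_contra h
  exact hp (support_fderiv_subset ℝ h)

lemma gradSnd_eq_zero_of_notMem {p : ℝ × EuclideanSpace ℝ (Fin d)} (hp : p ∉ tsupport φ) :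
    gradSnd φ p = 0 := by
  rw [gradSnd, fderiv_eq_zero_of_notMem hp, ContinuousLinearMap.zero_comp, map_zero]

lemma hasCompactSupport_gradSnd (hφ : IsTestFunction φ) : HasCompactSupport (gradSnd φ) :=
  HasCompactSupport.intro hφ.2.1 fun _ hp => gradSnd_eq_zero_of_notMem hp

lemma exists_box (hφ : IsTestFunction φ) : ∃ a b R : ℝ, 0 < a ∧ b < 1 ∧
    ∀ t x, gradSnd φ (t, x) ≠ 0 → t ∈ Icc a b ∧ x ∈ Metric.closedBall 0 R := by
  obtain ⟨a, b, ha, hb, hab⟩ := isCompact_subset_Ioo (hφ.2.1.isCompact.image continuous_fst)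
    (image_subset_iff.2 fun p hp => (hφ.2.2 hp).1)
  obtain ⟨R, hR⟩ := (hφ.2.1.isCompact.image continuous_snd).isBounded.subset_closedBall 0
  refine ⟨a, b, R, ha, hb, fun t x h => ?_⟩
  have hm : (t, x) ∈ tsupport φ := by
    by_contra h0
    exact h (gradSnd_eq_zero_of_notMem h0)
  exact ⟨hab ⟨_, hm, rfl⟩, hR ⟨_, hm, rfl⟩⟩

end IsTestFunction

end TestFunctions

/-! ### The continuity equation, pulled back to a fixed reference measure. -/

namespace AffineCurve

variable {d : ℕ} (c : AffineCurve d)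

/-- The product of the Lebesgue measure on `(0,1)` with the standard Gaussian measure. -/
noncomputable def refMeasure (d : ℕ) : Measure (ℝ × EuclideanSpace ℝ (Fin d)) :=
  (volume.restrict (Ioo (0 : ℝ) 1)).prod (stdGaussian (EuclideanSpace ℝ (Fin d)))

instance : IsFiniteMeasure (refMeasure d) := by
  unfold refMeasure
  infer_instance

/-- The flow, as a map of space-time. -/
noncomputable def gflow (p : ℝ × EuclideanSpace ℝ (Fin d)) : ℝ × EuclideanSpace ℝ (Fin d) :=
  (p.1, c.flow p.1 p.2)

lemma continuous_gflow : Continuous c.gflow := continuous_fst.prodMk c.continuous_flow_uncurry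

lemma lintegral_law (t : ℝ) {f : EuclideanSpace ℝ (Fin d) → ENNReal} (hf : Measurable f) :
    ∫⁻ x, f x ∂(c.law t) = ∫⁻ z, f (c.flow t z) ∂(stdGaussian (EuclideanSpace ℝ (Fin d))) :=
  lintegral_map hf (c.continuous_flow t).measurable

lemma integral_law {F : Type*} [NormedAddCommGroup F] [NormedSpace ℝ F]
    [SecondCountableTopology F] [MeasurableSpace F] [BorelSpace F] (t : ℝ)
    {f : EuclideanSpace ℝ (Fin d) → F} (hf : Measurable f) :
    ∫ x, f x ∂(c.law t) = ∫ z, f (c.flow t z) ∂(stdGaussian (EuclideanSpace ℝ (Fin d))) :=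
  integral_map (c.continuous_flow t).aemeasurable hf.aestronglyMeasurable

lemma lintegral_refMeasure {f : ℝ × EuclideanSpace ℝ (Fin d) → ENNReal} (hf : Measurable f) :
    ∫⁻ p, f (c.gflow p) ∂(refMeasure d) =
      ∫⁻ t in Ioo (0 : ℝ) 1, ∫⁻ x, f (t, x) ∂(c.law t) := by
  have hc : Measurable fun p => f (c.gflow p) := hf.comp c.continuous_gflow.measurable
  rw [refMeasure, lintegral_prod _ hc.aemeasurable]
  exact lintegral_congr fun t => (c.lintegral_law t (hf.comp measurable_prodMk_left)).symm

lemma integral_refMeasure {f : ℝ × EuclideanSpace ℝ (Fin d) → ℝ} (hf : Measurable f)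
    (hi : Integrable (fun p => f (c.gflow p)) (refMeasure d)) :
    ∫ p, f (c.gflow p) ∂(refMeasure d) =
      ∫ t in Ioo (0 : ℝ) 1, ∫ x, f (t, x) ∂(c.law t) := by
  rw [refMeasure, integral_prod _ hi]
  exact integral_congr_ae
    (ae_of_all _ fun t => (c.integral_law t (hf.comp measurable_prodMk_left)).symm)

/-- As `g` is bounded and vanishes outside a box, the integrand is dominated by `C ‖v‖` on that box,
where `v` is integrable for `μ_t dt`. -/
lemma integrable_inner {v : ℝ → EuclideanSpace ℝ (Fin d) → EuclideanSpace ℝ (Fin d)}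
    (hv : Measurable (Function.uncurry v))
    (hl : ∀ a b R : ℝ, 0 < a → b < 1 →
      ∫⁻ t in Icc a b, ∫⁻ x in Metric.closedBall 0 R, ‖v t x‖ₑ ∂(c.law t) < ⊤)
    {g : ℝ × EuclideanSpace ℝ (Fin d) → EuclideanSpace ℝ (Fin d)} (hg : Continuous g)
    {C : ℝ} (hC : ∀ p, ‖g p‖ ≤ C) {a b R : ℝ} (ha : 0 < a) (hb : b < 1)
    (hs : ∀ t x, g (t, x) ≠ 0 → t ∈ Icc a b ∧ x ∈ Metric.closedBall 0 R) :
    Integrable (fun p => ⟪v p.1 (c.flow p.1 p.2), g (p.1, c.flow p.1 p.2)⟫) (refMeasure d) := by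
  have hm : Measurable fun p : ℝ × EuclideanSpace ℝ (Fin d) => ⟪v p.1 p.2, g p⟫ :=
    Measurable.inner hv hg.measurable
  refine ⟨(hm.comp c.continuous_gflow.measurable).aestronglyMeasurable, ?_⟩
  have hmv (t : ℝ) : Measurable (v t) := hv.comp measurable_prodMk_left
  rw [HasFiniteIntegral]
  refine (c.lintegral_refMeasure hm.enorm).trans_lt ?_
  have h1 (t : ℝ) (x : EuclideanSpace ℝ (Fin d)) : ‖⟪v t x, g (t, x)⟫‖ₑ ≤
      (Icc a b).indicator 1 t *
        ((Metric.closedBall 0 R).indicator (fun x => ‖v t x‖ₑ) x * ENNReal.ofReal C) := by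
    by_cases h0 : g (t, x) = 0
    · simp [h0]
    · obtain ⟨ht, hx⟩ := hs t x h0
      rw [indicator_of_mem ht, indicator_of_mem hx, Pi.one_apply, one_mul, ← ofReal_norm,
        ← ofReal_norm, ← ENNReal.ofReal_mul (norm_nonneg _)]
      refine ENNReal.ofReal_le_ofReal ((norm_inner_le_norm _ _).trans ?_)
      have := hC (t, x)
      gcongr
  calc ∫⁻ t in Ioo (0 : ℝ) 1, ∫⁻ x, ‖⟪v t x, g (t, x)⟫‖ₑ ∂(c.law t)
      ≤ ∫⁻ t in Ioo (0 : ℝ) 1, (Icc a b).indicator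
          (fun t => (∫⁻ x in Metric.closedBall 0 R, ‖v t x‖ₑ ∂(c.law t)) * ENNReal.ofReal C) t := by
        refine lintegral_mono fun t => (lintegral_mono (h1 t)).trans_eq ?_
        by_cases ht : t ∈ Icc a b
        · simp_rw [indicator_of_mem ht, Pi.one_apply, one_mul]
          rw [lintegral_mul_const' _ _ (by simp), lintegral_indicator measurableSet_closedBall]
        · simp [indicator_of_notMem ht]
    _ ≤ ∫⁻ t, (Icc a b).indicator
          (fun t => (∫⁻ x in Metric.closedBall 0 R, ‖v t x‖ₑ ∂(c.law t)) * ENNReal.ofReal C) t :=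
        setLIntegral_le_lintegral _ _
    _ < ⊤ := by
        rw [lintegral_indicator measurableSet_Icc, lintegral_mul_const' _ _ (by simp)]
        exact ENNReal.mul_lt_top (hl a b R ha hb) (by simp)

lemma integrable_inner_gradSnd
    {v : ℝ → EuclideanSpace ℝ (Fin d) → EuclideanSpace ℝ (Fin d)}
    (hv : Measurable (Function.uncurry v))
    (hl : ∀ a b R : ℝ, 0 < a → b < 1 →
      ∫⁻ t in Icc a b, ∫⁻ x in Metric.closedBall 0 R, ‖v t x‖ₑ ∂(c.law t) < ⊤)
    {φ : ℝ × EuclideanSpace ℝ (Fin d) → ℝ} (hφ : IsTestFunction φ) :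
    Integrable (fun p => ⟪v p.1 (c.flow p.1 p.2), gradSnd φ (p.1, c.flow p.1 p.2)⟫)
      (refMeasure d) := by
  obtain ⟨a, b, R, ha, hb, hs⟩ := hφ.exists_box
  obtain ⟨C, hC⟩ := hφ.continuous_gradSnd.bounded_above_of_compact_support
    hφ.hasCompactSupport_gradSnd
  exact c.integrable_inner hv hl hφ.continuous_gradSnd hC ha hb hs

lemma integrable_fderiv_time {φ : ℝ × EuclideanSpace ℝ (Fin d) → ℝ} (hφ : IsTestFunction φ) :
    Integrable (fun p => fderiv ℝ φ (c.gflow p) (1, 0)) (refMeasure d) := by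
  obtain ⟨C, hC⟩ := hφ.continuous_fderiv.bounded_above_of_compact_support (hφ.2.1.fderiv ℝ)
  refine Integrable.of_bound (C := C * ‖((1 : ℝ), (0 : EuclideanSpace ℝ (Fin d)))‖)
    ((hφ.continuous_fderiv.comp c.continuous_gflow).clm_apply
      continuous_const).aestronglyMeasurable (ae_of_all _ fun p => ?_)
  exact ContinuousLinearMap.le_of_opNorm_le _ (hC _) _

/-- The weak form of the continuity equation, transported to the reference measure. -/
lemma integral_continuity_eq {v : ℝ → EuclideanSpace ℝ (Fin d) → EuclideanSpace ℝ (Fin d)}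
    (hv : Measurable (Function.uncurry v))
    (hl : ∀ a b R : ℝ, 0 < a → b < 1 →
      ∫⁻ t in Icc a b, ∫⁻ x in Metric.closedBall 0 R, ‖v t x‖ₑ ∂(c.law t) < ⊤)
    {φ : ℝ × EuclideanSpace ℝ (Fin d) → ℝ} (hφ : IsTestFunction φ) :
    ∫ t in Ioo (0 : ℝ) 1, ∫ x,
      (deriv (fun s => φ (s, x)) t + ⟪v t x, ∇ (fun y => φ (t, y)) x⟫) ∂(c.law t) =
    ∫ p, fderiv ℝ φ (c.gflow p) (1, 0) ∂(refMeasure d) +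
      ∫ p, ⟪v p.1 (c.flow p.1 p.2), gradSnd φ (p.1, c.flow p.1 p.2)⟫ ∂(refMeasure d) := by
  rw [← integral_add (c.integrable_fderiv_time hφ) (c.integrable_inner_gradSnd hv hl hφ)]
  simp_rw [deriv_fst_eq hφ.differentiable, gradient_snd_eq hφ.differentiable]
  have hm : Measurable fun q : ℝ × EuclideanSpace ℝ (Fin d) =>
      fderiv ℝ φ q (1, 0) + ⟪v q.1 q.2, gradSnd φ q⟫ :=
    (hφ.continuous_fderiv.clm_apply continuous_const).measurable.add
      (Measurable.inner hv hφ.continuous_gradSnd.measurable)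
  exact (c.integral_refMeasure hm ((c.integrable_fderiv_time hφ).add
    (c.integrable_inner_gradSnd hv hl hφ))).symm

lemma vel_locally_integrable (a b R : ℝ) :
    ∫⁻ t in Icc a b, ∫⁻ x in Metric.closedBall 0 R, ‖c.vel t x‖ₑ ∂(c.law t) < ⊤ := by
  obtain ⟨C, hC⟩ := (isCompact_Icc.prod (isCompact_closedBall (0 : EuclideanSpace ℝ (Fin d))
    R)).exists_bound_of_continuousOn (s := Icc a b ×ˢ _) c.continuous_vel.continuousOn
  calc _ ≤ ∫⁻ t in Icc a b, ENNReal.ofReal C := by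
        refine setLIntegral_mono measurable_const fun t ht => ?_
        calc _ ≤ ∫⁻ x in Metric.closedBall 0 R, ENNReal.ofReal C ∂(c.law t) := by
              refine setLIntegral_mono measurable_const fun x hx => ?_
              rw [← ofReal_norm]
              exact ENNReal.ofReal_le_ofReal (hC (t, x) ⟨ht, hx⟩)
          _ ≤ ∫⁻ x, ENNReal.ofReal C ∂(c.law t) := setLIntegral_le_lintegral _ _
          _ = ENNReal.ofReal C := by simp
    _ < ⊤ := by simp [ENNReal.mul_lt_top]

/-- The integrand is the time derivative of `φ` along the trajectory of `z`, and `φ` vanishes at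
both ends of the time interval. -/
lemma integral_time_derivative {φ : ℝ × EuclideanSpace ℝ (Fin d) → ℝ} (hφ : IsTestFunction φ)
    (z : EuclideanSpace ℝ (Fin d)) :
    ∫ t in Ioo (0 : ℝ) 1, (fderiv ℝ φ (c.gflow (t, z)) (1, 0) +
      ⟪c.vel t (c.flow t z), gradSnd φ (t, c.flow t z)⟫) = 0 := by
  have hg : Continuous fun t => c.gflow (t, z) :=
    c.continuous_gflow.comp (Continuous.prodMk_left z)
  have hz (t : ℝ) (ht : t ∉ Ioo (0 : ℝ) 1) : φ (c.gflow (t, z)) = 0 :=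
    image_eq_zero_of_notMem_tsupport fun h => ht (hφ.2.2 h).1
  have hcont : Continuous fun t => fderiv ℝ φ (c.gflow (t, z)) (1, 0) +
      ⟪c.vel t (c.flow t z), gradSnd φ (t, c.flow t z)⟫ :=
    ((hφ.continuous_fderiv.comp hg).clm_apply continuous_const).add
      ((c.continuous_vel.comp hg).inner (hφ.continuous_gradSnd.comp hg))
  have h := intervalIntegral.integral_eq_sub_of_hasDerivAt_of_le zero_le_one
    (f := fun t => φ (c.gflow (t, z))) (hφ.1.continuous.comp hg).continuousOn (fun t ht => ?_)
    (hcont.intervalIntegrable 0 1)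
  · rw [restrict_Ioo_eq_restrict_Ioc, ← intervalIntegral.integral_of_le zero_le_one]
    rw [h, hz 1 (by simp), hz 0 (by simp), sub_zero]
  · have h1 := (hφ.differentiable (c.gflow (t, z))).hasFDerivAt.comp_hasDerivAt t
      ((hasDerivAt_id t).prodMk (c.hasDerivAt_flow ht z))
    refine h1.congr_deriv ?_
    rw [inner_gradSnd]
    change _ = fderiv ℝ φ (c.gflow (t, z)) (1, 0) + fderiv ℝ φ (c.gflow (t, z)) (0, _)
    rw [← map_add]
    simp

lemma solvesCE_vel : SolvesCE c.law c.vel where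
  measurable := c.continuous_vel.measurable
  locally_integrable a b R _ _ := c.vel_locally_integrable a b R
  equation φ hφ := by
    have hm := c.continuous_vel.measurable
    have hl := fun a b R (_ : (0 : ℝ) < a) (_ : b < (1 : ℝ)) => c.vel_locally_integrable a b R
    have hi : Integrable (fun p => fderiv ℝ φ (c.gflow p) (1, 0) +
        ⟪c.vel p.1 (c.flow p.1 p.2), gradSnd φ (p.1, c.flow p.1 p.2)⟫) (refMeasure d) :=
      (c.integrable_fderiv_time hφ).add (c.integrable_inner_gradSnd hm hl hφ)
    -- Fubini with the time integral innermost: it vanishes for each fixed `z`.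
    rw [c.integral_continuity_eq hm hl hφ, ← integral_add (c.integrable_fderiv_time hφ)
      (c.integrable_inner_gradSnd hm hl hφ), refMeasure, integral_prod_symm _ hi]
    simp [c.integral_time_derivative hφ]

lemma admissible_vel : Admissible c.law c.vel :=
  ⟨c.solvesCE_vel, ae_of_all _ c.isTangent_vel⟩

end AffineCurve

/-! ### Countably many test gradients suffice, and the tangent space is closed. -/

section Separability

variable {d : ℕ}

/-- There are countably many smooth compactly supported functions whose gradients approximate
uniformly the gradient of any other one. -/
lemma exists_countable_dense_gradients (d : ℕ) :
    ∃ D : Set (EuclideanSpace ℝ (Fin d) → ℝ), D.Countable ∧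
      (∀ ψ ∈ D, ContDiff ℝ ∞ ψ ∧ HasCompactSupport ψ) ∧
      ∀ ψ : EuclideanSpace ℝ (Fin d) → ℝ, ContDiff ℝ ∞ ψ → HasCompactSupport ψ → ∀ ε > 0, ∃ ψ' ∈ D,
        ∀ x, ‖∇ ψ x - ∇ ψ' x‖ ≤ ε := by
  -- Continuous maps with the compact-open topology form a separable metrizable space, so each `T n`
  -- has a countable dense subset. Elements of `T n` vanish off the ball of radius `n`, which
  -- upgrades convergence on that ball to uniform convergence everywhere.
  let T (n : ℕ) : Set C(EuclideanSpace ℝ (Fin d), EuclideanSpace ℝ (Fin d)) :=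
    {f | ∃ ψ : EuclideanSpace ℝ (Fin d) → ℝ, (ContDiff ℝ ∞ ψ ∧ HasCompactSupport ψ) ∧
      (∀ x, f x = ∇ ψ x) ∧ ∀ x, x ∉ Metric.closedBall 0 (n : ℝ) → f x = 0}
  have hsep (n : ℕ) := TopologicalSpace.exists_countable_dense (T n)
  choose Q hQc hQd using hsep
  choose! F hF using fun (n : ℕ) (f : C(EuclideanSpace ℝ (Fin d), EuclideanSpace ℝ (Fin d)))
    (hf : f ∈ T n) => hf
  refine ⟨⋃ n, (fun f : T n => F n f.1) '' Q n,
    countable_iUnion fun n => (hQc n).image _, ?_, fun ψ hψ hψc ε hε => ?_⟩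
  · intro ψ hψ
    obtain ⟨n, f, -, rfl⟩ := mem_iUnion.1 hψ
    exact (hF n f.1 f.2).1
  · obtain ⟨R, hR⟩ := (hasCompactSupport_gradient hψc).isCompact.isBounded.subset_closedBall 0
    obtain ⟨n, hn⟩ := exists_nat_ge R
    have hzero (x : EuclideanSpace ℝ (Fin d)) (hx : x ∉ Metric.closedBall 0 (n : ℝ)) :
        ∇ ψ x = 0 :=
      image_eq_zero_of_notMem_tsupport fun h => hx (Metric.closedBall_subset_closedBall hn (hR h))
    let f : T n := ⟨⟨∇ ψ, continuous_gradient hψ⟩, ψ, ⟨hψ, hψc⟩, fun _ => rfl, hzero⟩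
    have h1 := ContinuousMap.tendsto_iff_forall_isCompact_tendstoUniformlyOn.1
      (tendsto_id (α := C(EuclideanSpace ℝ (Fin d), EuclideanSpace ℝ (Fin d))) (x := 𝓝 f.1))
      (Metric.closedBall 0 n) (isCompact_closedBall _ _)
    have h2 := continuous_subtype_val.tendsto f |>.eventually
      (Metric.tendstoUniformlyOn_iff.1 h1 ε hε)
    obtain ⟨g, hg, hgQ⟩ := mem_closure_iff_nhds.1 (hQd n f) _ h2
    refine ⟨F n g.1, mem_iUnion.2 ⟨n, g, hgQ, rfl⟩, fun x => ?_⟩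
    obtain ⟨-, hgF, hg0⟩ := hF n g.1 g.2
    rw [← hgF x]
    by_cases hx : x ∈ Metric.closedBall 0 (n : ℝ)
    · have := hg x hx
      rw [dist_eq_norm] at this
      exact this.le
    · rw [hg0 x hx, hzero x hx]
      simpa using hε.le

lemma isTestFunction_mul {η : ℝ → ℝ} {ψ : EuclideanSpace ℝ (Fin d) → ℝ} (hη : ContDiff ℝ ∞ η)
    (hηc : HasCompactSupport η) (hηs : tsupport η ⊆ Ioo 0 1) (hψ : ContDiff ℝ ∞ ψ)
    (hψc : HasCompactSupport ψ) :
    IsTestFunction fun p : ℝ × EuclideanSpace ℝ (Fin d) => η p.1 * ψ p.2 := by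
  have hs : tsupport (fun p : ℝ × EuclideanSpace ℝ (Fin d) => η p.1 * ψ p.2) ⊆
      tsupport η ×ˢ tsupport ψ := by
    refine closure_minimal (fun p hp => ?_) ((isClosed_tsupport _).prod (isClosed_tsupport _))
    exact ⟨subset_tsupport _ (left_ne_zero_of_mul hp), subset_tsupport _ (right_ne_zero_of_mul hp)⟩
  exact ⟨(hη.comp contDiff_fst).mul (hψ.comp contDiff_snd),
    (hηc.isCompact.prod hψc.isCompact).of_isClosed_subset (isClosed_tsupport _) hs,
    fun p hp => ⟨hηs (hs hp).1, mem_univ _⟩⟩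

lemma gradSnd_mul {η : ℝ → ℝ} {ψ : EuclideanSpace ℝ (Fin d) → ℝ} (hη : ContDiff ℝ ∞ η)
    (hψ : ContDiff ℝ ∞ ψ) (t : ℝ) (x : EuclideanSpace ℝ (Fin d)) :
    gradSnd (fun p : ℝ × EuclideanSpace ℝ (Fin d) => η p.1 * ψ p.2) (t, x) = η t • ∇ ψ x := by
  have hd : Differentiable ℝ fun p : ℝ × EuclideanSpace ℝ (Fin d) => η p.1 * ψ p.2 :=
    ((hη.comp contDiff_fst).mul (hψ.comp contDiff_snd)).differentiable (by simp)
  rw [← gradient_snd_eq hd]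
  refine HasGradientAt.gradient ?_
  rw [hasGradientAt_iff_hasFDerivAt, map_smul, toDual_gradient]
  exact (hψ.differentiable (by simp) x).hasFDerivAt.const_mul (η t)

/-- An element of the tangent space which is orthogonal to all gradients of test functions
vanishes; here for the difference of two tangent fields. -/
lemma ae_eq_of_isTangent {μ : Measure (EuclideanSpace ℝ (Fin d))}
    {v w : EuclideanSpace ℝ (Fin d) → EuclideanSpace ℝ (Fin d)} (hv : IsTangent μ v)
    (hw : IsTangent μ w)
    (h : ∀ ψ : EuclideanSpace ℝ (Fin d) → ℝ, ContDiff ℝ ∞ ψ → HasCompactSupport ψ →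
      ∫ x, ⟪v x - w x, ∇ ψ x⟫ ∂μ = 0) :
    v =ᵐ[μ] w := by
  obtain ⟨f, hf, hfv⟩ := hv
  obtain ⟨g, hg, hgw⟩ := hw
  have key : ∀ k ∈ tangentSpace μ, ⟪f - g, k⟫ = 0 := by
    intro k hk
    -- Orthogonality to `f - g` is a closed condition, so it need only be checked on gradients.
    refine closure_minimal (t := {k | ⟪f - g, k⟫ = 0}) ?_
      (isClosed_eq (by fun_prop) continuous_const) hk
    rintro k ⟨ψ, hψ, hψc, hk⟩
    rw [mem_ofPred_eq, L2.inner_def, ← h ψ hψ hψc]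
    refine integral_congr_ae ?_
    filter_upwards [hk, hfv, hgw, Lp.coeFn_sub f g] with x h1 h2 h3 h4
    rw [h1, h4, Pi.sub_apply, h2, h3]
  have h0 : ⟪f - g, f - g⟫ = 0 := by rw [inner_sub_right, key f hf, key g hg, sub_zero]
  have hfg : f = g := sub_eq_zero.1 (inner_self_eq_zero.1 h0)
  rw [hfg] at hfv
  exact hfv.symm.trans hgw

lemma IsTangent.memLp {μ : Measure (EuclideanSpace ℝ (Fin d))}
    {v : EuclideanSpace ℝ (Fin d) → EuclideanSpace ℝ (Fin d)} (hv : IsTangent μ v) :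
    MemLp v 2 μ := by
  obtain ⟨f, -, hf⟩ := hv
  exact (memLp_congr_ae hf).1 (Lp.memLp f)

/-- Replacing `ψ` by an element of `D` whose gradient is uniformly `ε`-close changes the integral by
at most `ε` times the `L¹` norm of `w`. -/
lemma integral_inner_gradient_eq_zero {μ : Measure (EuclideanSpace ℝ (Fin d))}
    {D : Set (EuclideanSpace ℝ (Fin d) → ℝ)}
    (hDs : ∀ ψ ∈ D, ContDiff ℝ ∞ ψ ∧ HasCompactSupport ψ)
    {w : EuclideanSpace ℝ (Fin d) → EuclideanSpace ℝ (Fin d)} (hw : Integrable w μ)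
    (h : ∀ ψ ∈ D, ∫ x, ⟪w x, ∇ ψ x⟫ ∂μ = 0) {ψ : EuclideanSpace ℝ (Fin d) → ℝ}
    (hψ : ContDiff ℝ ∞ ψ) (hψc : HasCompactSupport ψ)
    (hD : ∀ ε > 0, ∃ ψ' ∈ D, ∀ x, ‖∇ ψ x - ∇ ψ' x‖ ≤ ε) :
    ∫ x, ⟪w x, ∇ ψ x⟫ ∂μ = 0 := by
  have hint {ψ : EuclideanSpace ℝ (Fin d) → ℝ} (hψ : ContDiff ℝ ∞ ψ)
      (hψc : HasCompactSupport ψ) : Integrable (fun x => ⟪w x, ∇ ψ x⟫) μ := by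
    obtain ⟨C, hC⟩ := (continuous_gradient hψ).bounded_above_of_compact_support
      (hasCompactSupport_gradient hψc)
    refine (hw.norm.mul_const C).mono'
      (hw.1.inner (continuous_gradient hψ).aestronglyMeasurable) (ae_of_all _ fun x => ?_)
    refine (norm_inner_le_norm _ _).trans ?_
    have := hC x
    gcongr
  have hle (ε : ℝ) (hε : 0 < ε) :
      ‖∫ x, ⟪w x, ∇ ψ x⟫ ∂μ‖ ≤ ε * ∫ x, ‖w x‖ ∂μ := by
    obtain ⟨ψ', hψ', hc⟩ := hD ε hε
    have e : ∫ x, ⟪w x, ∇ ψ x⟫ ∂μ = ∫ x, ⟪w x, ∇ ψ x - ∇ ψ' x⟫ ∂μ := by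
      simp_rw [inner_sub_right]
      rw [integral_sub (hint hψ hψc) (hint (hDs ψ' hψ').1 (hDs ψ' hψ').2), h ψ' hψ', sub_zero]
    rw [e, ← integral_const_mul]
    refine norm_integral_le_of_norm_le (hw.norm.const_mul ε) (ae_of_all _ fun x => ?_)
    refine (norm_inner_le_norm _ _).trans ?_
    rw [mul_comm]
    have := hc x
    gcongr
  have ht : Tendsto (fun ε : ℝ => ε * ∫ x, ‖w x‖ ∂μ) (𝓝[>] 0) (𝓝 0) := by
    have : Tendsto (fun ε : ℝ => ε * ∫ x, ‖w x‖ ∂μ) (𝓝 0) (𝓝 (0 * ∫ x, ‖w x‖ ∂μ)) :=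
      tendsto_id.mul_const _
    rw [zero_mul] at this
    exact this.mono_left nhdsWithin_le_nhds
  have := ge_of_tendsto ht (eventually_nhdsWithin_of_forall hle)
  exact norm_le_zero_iff.1 this

end Separability

/-! ### Uniqueness of the admissible velocity and the path energy. -/

namespace AffineCurve

variable {d : ℕ} (c : AffineCurve d)

/-- Test both continuity equations against `η(t) ψ(x)` and subtract: the time-derivative terms
cancel, leaving `∫ η g = 0` for every `η`, and the fundamental lemma of the calculus of variations
gives `g = 0`. -/
lemma ae_integral_inner_eq_zero
    {v : ℝ → EuclideanSpace ℝ (Fin d) → EuclideanSpace ℝ (Fin d)} (hv : SolvesCE c.law v)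
    {ψ : EuclideanSpace ℝ (Fin d) → ℝ} (hψ : ContDiff ℝ ∞ ψ) (hψc : HasCompactSupport ψ) :
    ∀ᵐ t ∂(volume.restrict (Ioo (0 : ℝ) 1)), ∫ x, ⟪v t x - c.vel t x, ∇ ψ x⟫ ∂(c.law t) = 0 := by
  let g (t : ℝ) : ℝ := ∫ x, ⟪v t x - c.vel t x, ∇ ψ x⟫ ∂(c.law t)
  have hu := c.solvesCE_vel
  have hwm : Measurable fun p : ℝ × EuclideanSpace ℝ (Fin d) => v p.1 p.2 - c.vel p.1 p.2 :=
    hv.measurable.sub hu.measurable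
  have hmain {η : ℝ → ℝ} (hη : ContDiff ℝ ∞ η) (hηc : HasCompactSupport η)
      (hηs : tsupport η ⊆ Ioo 0 1) :
      IntegrableOn (fun t => η t • g t) (Ioo 0 1) ∧ ∫ t in Ioo (0 : ℝ) 1, η t • g t = 0 := by
    have hφ := isTestFunction_mul hη hηc hηs hψ hψc
    have iv := c.integrable_inner_gradSnd hv.measurable hv.locally_integrable hφ
    have iu := c.integrable_inner_gradSnd hu.measurable hu.locally_integrable hφ
    have ev := c.integral_continuity_eq hv.measurable hv.locally_integrable hφ
    have eu := c.integral_continuity_eq hu.measurable hu.locally_integrable hφ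
    rw [hv.equation _ hφ] at ev
    rw [hu.equation _ hφ] at eu
    have hi := iv.sub iu
    have he : (fun t => η t • g t) = fun t => ∫ z, (⟪v t (c.flow t z),
        gradSnd (fun p : ℝ × EuclideanSpace ℝ (Fin d) => η p.1 * ψ p.2) (t, c.flow t z)⟫ -
        ⟪c.vel t (c.flow t z),
        gradSnd (fun p : ℝ × EuclideanSpace ℝ (Fin d) => η p.1 * ψ p.2) (t, c.flow t z)⟫)
        ∂(stdGaussian (EuclideanSpace ℝ (Fin d))) := by
      ext t
      have hmt : Measurable fun x => ⟪v t x - c.vel t x, ∇ ψ x⟫ :=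
        (hwm.comp measurable_prodMk_left).inner (continuous_gradient hψ).measurable
      simp only [g]
      rw [c.integral_law t hmt, smul_eq_mul, ← integral_const_mul]
      refine integral_congr_ae (ae_of_all _ fun z => ?_)
      simp only [gradSnd_mul hη hψ]
      rw [← inner_sub_left, inner_smul_right]
    rw [he]
    refine ⟨hi.integral_prod_left, ?_⟩
    have := integral_prod _ hi
    simp only [Pi.sub_apply] at this
    rw [← this]
    change ∫ p, (_ - _) ∂(refMeasure d) = 0
    rw [integral_sub iv iu]
    linarith
  -- Integrability is known only for `η g`; a bump `η` equal to `1` near `t₀` gives it for `g`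
  -- there.
  have hloc : LocallyIntegrableOn g (Ioo 0 1) := by
    intro t₀ ht₀
    obtain ⟨r, hr, hrs⟩ := Metric.isOpen_iff.1 isOpen_Ioo t₀ ht₀
    let η : ContDiffBump t₀ := ⟨r / 3, r / 2, by positivity, by linarith⟩
    have hηs : tsupport η ⊆ Ioo 0 1 := by
      rw [η.tsupport_eq]
      exact (Metric.closedBall_subset_ball (by simp only [η]; linarith)).trans hrs
    refine ⟨Ioo 0 1 ∩ Metric.ball t₀ (r / 3),
      inter_mem_nhdsWithin _ (Metric.ball_mem_nhds _ (by positivity)), ?_⟩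
    refine ((hmain η.contDiff η.hasCompactSupport hηs).1.mono_set inter_subset_left).congr_fun
      (fun t ht => ?_) (measurableSet_Ioo.inter measurableSet_ball)
    simp only
    rw [η.one_of_mem_closedBall (Metric.ball_subset_closedBall ht.2), one_smul]
  rw [ae_restrict_iff' measurableSet_Ioo]
  refine isOpen_Ioo.ae_eq_zero_of_integral_contDiff_smul_eq_zero hloc fun η hη hηc hηs => ?_
  rw [← (hmain hη hηc hηs).2]
  refine (setIntegral_eq_integral_of_forall_compl_eq_zero fun t ht => ?_).symm
  rw [image_eq_zero_of_notMem_tsupport fun h => ht (hηs h), zero_smul]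

/-- The velocity field is the only admissible field. -/
lemma ae_eq_vel_of_admissible
    {v : ℝ → EuclideanSpace ℝ (Fin d) → EuclideanSpace ℝ (Fin d)} (hv : Admissible c.law v) :
    ∀ᵐ t ∂(volume.restrict (Ioo (0 : ℝ) 1)), v t =ᵐ[c.law t] c.vel t := by
  obtain ⟨D, hDc, hDs, hD⟩ := exists_countable_dense_gradients d
  -- The exceptional set of times depends on `ψ`; countability of `D` provides a single null set
  -- valid for all of `D`.
  have h := (ae_ball_iff hDc).2 fun ψ hψ =>
    c.ae_integral_inner_eq_zero hv.1 (hDs ψ hψ).1 (hDs ψ hψ).2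
  filter_upwards [h, hv.2] with t ht htan
  refine ae_eq_of_isTangent htan (c.isTangent_vel t) fun ψ hψ hψc => ?_
  exact integral_inner_gradient_eq_zero hDs
    ((htan.memLp.sub (c.memLp_vel t)).integrable (by norm_num)) ht hψ hψc (hD ψ hψ hψc)

lemma pathEnergy_law : pathEnergy c.law = actionIntegral c.law c.vel := by
  refine le_antisymm (iInf₂_le _ c.admissible_vel) (le_iInf₂ fun v hv => ?_)
  exact (c.actionIntegral_congr (c.ae_eq_vel_of_admissible hv)).ge

end AffineCurve

/-! ### The distributional acceleration and the spline energy. -/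

lemma inner_had_left {d : ℕ} (a b e : EuclideanSpace ℝ (Fin d)) :
    ⟪had a b, e⟫ = ⟪b, had a e⟫ := by
  simp only [PiLp.inner_apply, had_apply]
  refine Finset.sum_congr rfl fun i _ => ?_
  simp
  ring

lemma LocallyIntegrableOn.integrable_smul {d : ℕ}
    {a : ℝ × EuclideanSpace ℝ (Fin d) → EuclideanSpace ℝ (Fin d)}
    (ha : LocallyIntegrableOn a (Ioo (0 : ℝ) 1 ×ˢ univ))
    {φ : ℝ × EuclideanSpace ℝ (Fin d) → ℝ} (hφ : IsTestFunction φ) :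
    Integrable fun p => φ p • a p := by
  have h := (ha.integrableOn_compact_subset hφ.2.2 hφ.2.1.isCompact).continuousOn_smul
    hφ.1.continuous.continuousOn hφ.2.1.isCompact
  refine (integrableOn_iff_integrable_of_support_subset fun p hp => ?_).1 h
  exact subset_tsupport _ fun h0 => hp (by simp [h0])

namespace AffineCurve

variable {d : ℕ} (c : AffineCurve d)

/-- The convective term `½ ∇|v|²` of the acceleration. -/
noncomputable def convect (t : ℝ) (x : EuclideanSpace ℝ (Fin d)) : EuclideanSpace ℝ (Fin d) :=
  had (c.S₁ t) (had (hinv (c.S t)) (c.vel t x))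

lemma continuous_convect : Continuous (Function.uncurry c.convect) :=
  continuous_had (c.contS₁.comp continuous_fst)
    (continuous_had (c.continuous_hinv.comp continuous_fst) c.continuous_vel)

/-- Acceleration is the derivative of velocity along trajectories, `∂ₜv + (Dv) v`; at a fixed point
of space the transport term `(Dv) v`, which is `convect`, has to be removed. -/
lemma hasDerivAt_vel {t : ℝ} (ht : t ∈ Ioo (0 : ℝ) 1) (x : EuclideanSpace ℝ (Fin d)) :
    HasDerivAt (fun s => c.vel s x) (c.acc t x - c.convect t x) t := by
  rw [hasDerivAt_euclidean]
  intro i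
  have hM := hasDerivAt_euclidean.1 (c.derivM t ht) i
  have hM₁ := hasDerivAt_euclidean.1 (c.derivM₁ t ht) i
  have hS := hasDerivAt_euclidean.1 (c.derivS t ht) i
  have hS₁ := hasDerivAt_euclidean.1 (c.derivS₁ t ht) i
  have hne := c.S_ne t i
  refine (hM₁.add (hS₁.mul ((hS.inv hne).mul (hM.const_sub (x i))))).congr_deriv ?_
  simp [acc, convect, vel, back]
  field_simp
  ring

/-- The spatial Jacobian of the velocity is diagonal, hence self-adjoint, and moves across the inner
product. This identifies `(Dv) v` with `½∇|v|²`. -/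
lemma hasDerivAt_norm_sq_vel (t : ℝ) (x e : EuclideanSpace ℝ (Fin d)) :
    HasDerivAt (fun s : ℝ => (1 / 2 : ℝ) * ‖c.vel t (x + s • e)‖ ^ 2) ⟪c.convect t x, e⟫ 0 := by
  have h : HasDerivAt (fun s : ℝ => c.vel t (x + s • e))
      (had (c.S₁ t) (had (hinv (c.S t)) e)) 0 := by
    rw [hasDerivAt_euclidean]
    intro i
    have h0 : HasDerivAt (fun s : ℝ => x i + s * e i - c.M t i) (e i) 0 := by
      simpa using (((hasDerivAt_id (0 : ℝ)).mul_const (e i)).const_add (x i)).sub_const (c.M t i)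
    exact ((h0.const_mul ((c.S t i)⁻¹)).const_mul (c.S₁ t i)).const_add (c.M₁ t i)
  refine (h.norm_sq.const_mul (1 / 2 : ℝ)).congr_deriv ?_
  rw [convect, inner_had_left, inner_had_left, zero_smul, add_zero]
  have : had (hinv (c.S t)) (had (c.S₁ t) e) = had (c.S₁ t) (had (hinv (c.S t)) e) := by
    ext i; simp; ring
  rw [this]
  ring

/-- The component along `e` of the weak equation: integrate by parts along `(1, 0)` and along `(0,
e)`; the two `convect` terms then cancel. -/
lemma integral_acceleration {φ : ℝ × EuclideanSpace ℝ (Fin d) → ℝ} (hφ : IsTestFunction φ)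
    (e : EuclideanSpace ℝ (Fin d)) :
    ∫ p : ℝ × EuclideanSpace ℝ (Fin d), (⟪c.vel p.1 p.2, e⟫ * fderiv ℝ φ p (1, 0) +
      (1 / 2 : ℝ) * ‖c.vel p.1 p.2‖ ^ 2 * fderiv ℝ φ p (0, e)) =
    - ∫ p : ℝ × EuclideanSpace ℝ (Fin d), φ p * ⟪c.acc p.1 p.2, e⟫ := by
  have hvel : Continuous fun p : ℝ × EuclideanSpace ℝ (Fin d) => c.vel p.1 p.2 := c.continuous_vel
  have hacc : Continuous fun p : ℝ × EuclideanSpace ℝ (Fin d) => c.acc p.1 p.2 := c.continuous_acc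
  have hcon : Continuous fun p : ℝ × EuclideanSpace ℝ (Fin d) => c.convect p.1 p.2 :=
    c.continuous_convect
  have hcφ := hφ.1.continuous
  have hi {f : ℝ × EuclideanSpace ℝ (Fin d) → ℝ} (hf : Continuous f) :
      Integrable fun p => f p * φ p :=
    (hf.mul hcφ).integrable_of_hasCompactSupport hφ.2.1.mul_left
  have hi' {f : ℝ × EuclideanSpace ℝ (Fin d) → ℝ} (hf : Continuous f)
      (w : ℝ × EuclideanSpace ℝ (Fin d)) : Integrable fun p => f p * fderiv ℝ φ p w := by
    refine (hf.mul (hφ.continuous_fderiv.clm_apply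
      continuous_const)).integrable_of_hasCompactSupport
      (HasCompactSupport.intro hφ.2.1 fun p hp => ?_)
    rw [Pi.mul_apply, IsTestFunction.fderiv_eq_zero_of_notMem hp, _root_.zero_apply, mul_zero]
  have hd (p w : ℝ × EuclideanSpace ℝ (Fin d)) : HasLineDerivAt ℝ φ (fderiv ℝ φ p w) p w :=
    (hφ.differentiable p).hasFDerivAt.hasLineDerivAt w
  have c1 : Continuous fun p : ℝ × EuclideanSpace ℝ (Fin d) => ⟪c.vel p.1 p.2, e⟫ := by fun_prop
  have c2 : Continuous fun p : ℝ × EuclideanSpace ℝ (Fin d) =>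
      ⟪c.acc p.1 p.2 - c.convect p.1 p.2, e⟫ := by fun_prop
  have c3 : Continuous fun p : ℝ × EuclideanSpace ℝ (Fin d) =>
      (1 / 2 : ℝ) * ‖c.vel p.1 p.2‖ ^ 2 := by fun_prop
  have c4 : Continuous fun p : ℝ × EuclideanSpace ℝ (Fin d) => ⟪c.convect p.1 p.2, e⟫ := by fun_prop
  have : (volume : Measure (ℝ × EuclideanSpace ℝ (Fin d))).IsAddHaarMeasure := by
    rw [Measure.volume_eq_prod]
    infer_instance
  have h1 := integral_bilinear_hasLineDerivAt_right_eq_neg_left_of_integrable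
    (μ := (volume : Measure (ℝ × EuclideanSpace ℝ (Fin d)))) (B := ContinuousLinearMap.mul ℝ ℝ)
    (hi c2) (hi' c1 (1, 0)) (hi c1) (fun p hp => ?_) (fun p _ => hd p (1, 0))
  have h2 := integral_bilinear_hasLineDerivAt_right_eq_neg_left_of_integrable
    (μ := (volume : Measure (ℝ × EuclideanSpace ℝ (Fin d)))) (B := ContinuousLinearMap.mul ℝ ℝ)
    (hi c4) (hi' c3 (0, e)) (hi c3) (fun p hp => ?_) (fun p _ => hd p (0, e))
  · simp only [ContinuousLinearMap.mul_apply'] at h1 h2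
    rw [integral_add (hi' c1 (1, 0)) (hi' c3 (0, e)), h1, h2, ← neg_add,
      ← integral_add (hi c2) (hi c4)]
    congr 2
    ext p
    rw [← add_mul, ← inner_add_left, sub_add_cancel, mul_comm]
  · simpa [HasLineDerivAt] using c.hasDerivAt_norm_sq_vel p.1 p.2 e
  -- The time derivative exists only inside the strip, which is enough because it is needed only on
  -- the support of `φ`.
  · have hv := c.hasDerivAt_vel (hφ.2.2 hp).1 p.2
    have hv' : HasDerivAt (fun s => ⟪c.vel s p.2, e⟫)
        ⟪c.acc p.1 p.2 - c.convect p.1 p.2, e⟫ (p.1 + 0) := by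
      simpa using hv.inner ℝ (hasDerivAt_const p.1 e)
    have := hv'.comp_const_add p.1 0
    simpa [HasLineDerivAt] using this

lemma isAcceleration_acc : IsAcceleration c.vel c.acc where
  measurable := c.continuous_acc.measurable
  velocity := c.continuous_vel.locallyIntegrable.locallyIntegrableOn _
  velocity_sq := (c.continuous_vel.norm.pow 2).locallyIntegrable.locallyIntegrableOn _
  acceleration := c.continuous_acc.locallyIntegrable.locallyIntegrableOn _
  equation φ hφ := by
    have hvel : Continuous fun p : ℝ × EuclideanSpace ℝ (Fin d) => c.vel p.1 p.2 :=
      c.continuous_vel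
    have hcφ := hφ.1.continuous
    simp_rw [deriv_fst_eq hφ.differentiable, gradient_snd_eq hφ.differentiable]
    rw [setIntegral_eq_integral_of_forall_compl_eq_zero fun p hp => ?_,
      setIntegral_eq_integral_of_forall_compl_eq_zero fun p hp => ?_]
    · have i1 : Integrable fun p : ℝ × EuclideanSpace ℝ (Fin d) =>
          fderiv ℝ φ (p.1, p.2) (1, 0) • c.vel p.1 p.2
            + ((1 / 2 : ℝ) * ‖c.vel p.1 p.2‖ ^ 2) • gradSnd φ (p.1, p.2) := by
        refine Continuous.integrable_of_hasCompactSupport ?_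
          (HasCompactSupport.intro hφ.2.1 fun p hp => ?_)
        · exact ((hφ.continuous_fderiv.clm_apply continuous_const).smul hvel).add
            ((continuous_const.mul (hvel.norm.pow 2)).smul hφ.continuous_gradSnd)
        · simp [IsTestFunction.fderiv_eq_zero_of_notMem hp, IsTestFunction.gradSnd_eq_zero_of_notMem hp]
      have i2 : Integrable fun p : ℝ × EuclideanSpace ℝ (Fin d) => φ p • c.acc p.1 p.2 :=
        LocallyIntegrableOn.integrable_smul
          (c.continuous_acc.locallyIntegrable.locallyIntegrableOn _) hφ
      refine ext_inner_left ℝ fun e => ?_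
      rw [inner_neg_right, ← integral_inner i1, ← integral_inner i2]
      have := c.integral_acceleration hφ e
      simp only [inner_add_right, inner_smul_right, inner_gradSnd, Prod.mk.eta]
      simp only [real_inner_comm e] at this ⊢
      rw [← this]
      refine integral_congr_ae (ae_of_all _ fun p => ?_)
      simp only
      ring
    · rw [image_eq_zero_of_notMem_tsupport fun h => hp (hφ.2.2 h), zero_smul]
    · have hp' : p ∉ tsupport φ := fun h => hp (hφ.2.2 h)
      simp [IsTestFunction.fderiv_eq_zero_of_notMem hp', IsTestFunction.gradSnd_eq_zero_of_notMem hp']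

lemma ae_eq_acc_of_isAcceleration
    {v a : ℝ → EuclideanSpace ℝ (Fin d) → EuclideanSpace ℝ (Fin d)} (hv : Admissible c.law v)
    (ha : IsAcceleration v a) :
    ∀ᵐ t ∂(volume.restrict (Ioo (0 : ℝ) 1)), a t =ᵐ[c.law t] c.acc t := by
  have hstrip : MeasurableSet (Ioo (0 : ℝ) 1 ×ˢ (univ : Set (EuclideanSpace ℝ (Fin d)))) :=
    measurableSet_Ioo.prod MeasurableSet.univ
  have hvu := (c.ae_ae_law_iff (measurableSet_eq_fun hv.1.measurable
    c.continuous_vel.measurable)).1 (c.ae_eq_vel_of_admissible hv)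
  refine (c.ae_ae_law_iff (measurableSet_eq_fun ha.measurable
    c.continuous_acc.measurable)).2 ?_
  have hacc := c.isAcceleration_acc
  rw [ae_restrict_iff' hstrip]
  have h := (isOpen_Ioo.prod isOpen_univ).ae_eq_zero_of_integral_contDiff_smul_eq_zero
    (ha.acceleration.sub hacc.acceleration) fun φ hφ hφc hφs => ?_
  · filter_upwards [h] with p hp hps
    exact sub_eq_zero.1 (hp hps)
  · have ht : IsTestFunction φ := ⟨hφ, hφc, hφs⟩
    have i1 := LocallyIntegrableOn.integrable_smul ha.acceleration ht
    have i2 := LocallyIntegrableOn.integrable_smul hacc.acceleration ht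
    have e1 := ha.equation φ ht
    have e2 := hacc.equation φ ht
    -- The left sides of the two weak equations agree because `v` equals `c.vel` Lebesgue-almost
    -- everywhere on the strip.
    have e3 : ∫ p in Ioo (0 : ℝ) 1 ×ˢ (univ : Set (EuclideanSpace ℝ (Fin d))), φ p • a p.1 p.2 =
        ∫ p in Ioo (0 : ℝ) 1 ×ˢ (univ : Set (EuclideanSpace ℝ (Fin d))),
          φ p • c.acc p.1 p.2 := by
      rw [← neg_inj, ← e1, ← e2]
      refine integral_congr_ae ?_
      filter_upwards [hvu] with p hp
      simp only [Function.uncurry] at hp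
      rw [hp]
    have hz {b : ℝ × EuclideanSpace ℝ (Fin d) → EuclideanSpace ℝ (Fin d)} :
        ∫ p in Ioo (0 : ℝ) 1 ×ˢ (univ : Set (EuclideanSpace ℝ (Fin d))), φ p • b p =
        ∫ p, φ p • b p :=
      setIntegral_eq_integral_of_forall_compl_eq_zero fun p hp => by
        rw [image_eq_zero_of_notMem_tsupport fun h => hp (hφs h), zero_smul]
    rw [hz, hz] at e3
    simp only [Pi.sub_apply, smul_sub]
    rw [integral_sub i1 i2, e3, sub_self]

lemma splineEnergy_law : splineEnergy c.law = actionIntegral c.law c.acc := by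
  refine le_antisymm ((iInf₂_le _ c.admissible_vel).trans (iInf₂_le _ c.isAcceleration_acc))
    (le_iInf₂ fun v hv => le_iInf₂ fun a ha => ?_)
  exact (c.actionIntegral_congr (c.ae_eq_acc_of_isAcceleration hv ha)).ge

end AffineCurve

/-! ### The energies depend only on the measures at interior times. -/

section Congr

variable {d : ℕ} {μ ν : ℝ → Measure (EuclideanSpace ℝ (Fin d))}

lemma actionIntegral_congr_measure (h : ∀ t ∈ Ioo (0 : ℝ) 1, μ t = ν t)
    (v : ℝ → EuclideanSpace ℝ (Fin d) → EuclideanSpace ℝ (Fin d)) :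
    actionIntegral μ v = actionIntegral ν v :=
  setLIntegral_congr_fun measurableSet_Ioo fun t ht => by simp only [h t ht]

lemma Admissible.congr_measure (h : ∀ t ∈ Ioo (0 : ℝ) 1, μ t = ν t)
    {v : ℝ → EuclideanSpace ℝ (Fin d) → EuclideanSpace ℝ (Fin d)} (hv : Admissible μ v) :
    Admissible ν v := by
  refine ⟨⟨hv.1.measurable, fun a b R ha hb => ?_, fun φ hφ => ?_⟩, ?_⟩
  · rw [setLIntegral_congr_fun (g := fun t => ∫⁻ x in Metric.closedBall 0 R, ‖v t x‖ₑ ∂(μ t))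
      measurableSet_Icc fun t ht => by
        simp only [h t ⟨ha.trans_le ht.1, ht.2.trans_lt hb⟩]]
    exact hv.1.locally_integrable a b R ha hb
  · refine Eq.trans ?_ (hv.1.equation φ hφ)
    exact setIntegral_congr_fun measurableSet_Ioo fun t ht => by simp only [h t ht]
  · filter_upwards [hv.2, ae_restrict_mem measurableSet_Ioo] with t ht hm
    rw [← h t hm]
    exact ht

lemma admissible_congr_measure (h : ∀ t ∈ Ioo (0 : ℝ) 1, μ t = ν t)
    (v : ℝ → EuclideanSpace ℝ (Fin d) → EuclideanSpace ℝ (Fin d)) :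
    Admissible μ v ↔ Admissible ν v :=
  ⟨fun hv => hv.congr_measure h, fun hv => hv.congr_measure fun t ht => (h t ht).symm⟩

lemma pathEnergy_congr (h : ∀ t ∈ Ioo (0 : ℝ) 1, μ t = ν t) : pathEnergy μ = pathEnergy ν := by
  simp only [pathEnergy, admissible_congr_measure h, actionIntegral_congr_measure h]

lemma splineEnergy_congr (h : ∀ t ∈ Ioo (0 : ℝ) 1, μ t = ν t) :
    splineEnergy μ = splineEnergy ν := by
  simp only [splineEnergy, admissible_congr_measure h, actionIntegral_congr_measure h]

end Congr

/-! ### Extending curves from `[0,1]` to the real line. -/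

section Extension

variable {F : Type*}

/-- The continuous extension of a function on `[0,1]`, constant on either side. -/
noncomputable def ext01 (f : ℝ → F) : ℝ → F :=
  IccExtend zero_le_one (fun t : Icc (0 : ℝ) 1 => f t)

lemma ext01_of_mem (f : ℝ → F) {t : ℝ} (ht : t ∈ Icc (0 : ℝ) 1) : ext01 f t = f t :=
  IccExtend_of_mem _ _ ht

lemma ext01_mem (f : ℝ → F) (t : ℝ) : ∃ s ∈ Icc (0 : ℝ) 1, ext01 f t = f s :=
  ⟨_, (projIcc 0 1 zero_le_one t).2, rfl⟩

lemma continuous_ext01 [TopologicalSpace F] {f : ℝ → F} (hf : ContinuousOn f (Icc 0 1)) : Continuous (ext01 f) :=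
  (continuousOn_iff_continuous_domRestrict.1 hf).Icc_extend'

variable [NormedAddCommGroup F]

/-- Interior times only: the constant extension may have corners at `0` and `1`. -/
lemma hasDerivAt_ext01 [NormedSpace ℝ F] {f : ℝ → F} (hf : DifferentiableOn ℝ f (Icc 0 1)) {t : ℝ}
    (ht : t ∈ Ioo (0 : ℝ) 1) :
    HasDerivAt (ext01 f) (ext01 (derivWithin f (Icc 0 1)) t) t := by
  have hI : Icc (0 : ℝ) 1 ∈ 𝓝 t := Icc_mem_nhds ht.1 ht.2
  rw [ext01_of_mem _ (Ioo_subset_Icc_self ht)]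
  have h := (hf t (Ioo_subset_Icc_self ht)).hasDerivWithinAt.hasDerivAt hI
  refine h.congr_of_eventuallyEq ?_
  filter_upwards [hI] with s hs using ext01_of_mem f hs

lemma integral_ext01 (f : ℝ → F) :
    ∫ t in (0 : ℝ)..1, ‖ext01 f t‖ ^ 2 = ∫ t in (0 : ℝ)..1, ‖f t‖ ^ 2 := by
  refine intervalIntegral.integral_congr fun t ht => ?_
  rw [uIcc_of_le zero_le_one] at ht
  simp only [ext01_of_mem f ht]

lemma iteratedDerivWithin_two [NormedSpace ℝ F] (f : ℝ → F) :
    iteratedDerivWithin 2 f (Icc (0 : ℝ) 1) =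
      derivWithin (derivWithin f (Icc 0 1)) (Icc 0 1) := by
  rw [iteratedDerivWithin_succ']
  exact iteratedDerivWithin_one

end Extension

/-! ### From diagonal covariance curves to affine flows. -/

section Diagonal

variable {d : ℕ}

/-- The diagonal of a matrix, as a continuous linear map to the Euclidean space. -/
noncomputable def diagVec (d : ℕ) : Matrix (Fin d) (Fin d) ℝ →L[ℝ] EuclideanSpace ℝ (Fin d) :=
  LinearMap.toContinuousLinearMap
    { toFun := fun A => WithLp.toLp 2 A.diag
      map_add' := fun _ _ => rfl
      map_smul' := fun _ _ => rfl }

@[simp] lemma diagVec_apply (A : Matrix (Fin d) (Fin d) ℝ) (i : Fin d) :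
    diagVec d A i = A i i := rfl

/-- An entry of a matrix, as a continuous linear map. -/
noncomputable def entry (i j : Fin d) : Matrix (Fin d) (Fin d) ℝ →L[ℝ] ℝ :=
  LinearMap.toContinuousLinearMap (Matrix.entryLinearMap ℝ ℝ i j)

lemma norm_diagVec {A : Matrix (Fin d) (Fin d) ℝ} (hA : A.IsDiag) : ‖diagVec d A‖ = ‖A‖ := by
  conv_rhs => rw [← hA.diagonal_diag, Matrix.frobenius_norm_diagonal]
  rfl

/-- Off-diagonal entries vanish near `t`, hence so do their derivatives at `t`. -/
lemma isDiag_of_hasDerivAt {σ : ℝ → Matrix (Fin d) (Fin d) ℝ} {A : Matrix (Fin d) (Fin d) ℝ}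
    {t : ℝ} (h : HasDerivAt σ A t) (hσ : ∀ᶠ s in 𝓝 t, (σ s).IsDiag) : A.IsDiag := by
  intro i j hij
  have h1 : HasDerivAt (fun s => entry i j (σ s)) (entry i j A) t :=
    (entry i j).hasFDerivAt.comp_hasDerivAt t h
  have h2 : HasDerivAt (fun s => entry i j (σ s)) 0 t :=
    (hasDerivAt_const t (0 : ℝ)).congr_of_eventuallyEq (by
      filter_upwards [hσ] with s hs using hs hij)
  exact h1.unique h2

/-- On diagonal matrices the Frobenius norm is the Euclidean norm of the diagonal; the endpoints are
null for the integral. -/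
lemma integral_norm_sq_diagVec {A : ℝ → Matrix (Fin d) (Fin d) ℝ}
    (hA : ∀ t ∈ Ioo (0 : ℝ) 1, (A t).IsDiag) :
    ∫ t in (0 : ℝ)..1, ‖diagVec d (A t)‖ ^ 2 = ∫ t in (0 : ℝ)..1, ‖A t‖ ^ 2 := by
  rw [intervalIntegral.integral_of_le zero_le_one, intervalIntegral.integral_of_le zero_le_one,
    ← restrict_Ioo_eq_restrict_Ioc]
  exact setIntegral_congr_fun measurableSet_Ioo fun t ht => by simp only [norm_diagVec (hA t ht)]

-- The Gaussian is defined through the positive square root of its covariance, and that root of `A ^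
-- 2` is `A` itself by positivity.
open scoped MatrixOrder in
lemma multivariateGaussian_sq_of_isDiag (b : EuclideanSpace ℝ (Fin d))
    {A : Matrix (Fin d) (Fin d) ℝ} (hd : A.IsDiag) (hp : A.PosDef) :
    multivariateGaussian b (A ^ 2) =
      (stdGaussian (EuclideanSpace ℝ (Fin d))).map (fun z => b + had (diagVec d A) z) := by
  rw [multivariateGaussian, CFC.sqrt_sq A hp.posSemidef.nonneg]
  congr 1
  ext1 z
  congr 1
  ext i
  conv_lhs => rw [← hd.diagonal_diag]
  rw [Matrix.ofLp_toEuclideanCLM, Matrix.mulVec_diagonal]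
  rfl

/-- The curve of affine maps which transports the standard Gaussian measure to the Gaussian
measures of means `m` and covariances `σ²`. -/
noncomputable def gaussianCurve {m : ℝ → EuclideanSpace ℝ (Fin d)}
    {σ : ℝ → Matrix (Fin d) (Fin d) ℝ} (hm : ContDiffOn ℝ 2 m (Icc 0 1))
    (hσ : ContDiffOn ℝ 2 σ (Icc 0 1)) (hpos : ∀ t ∈ Icc (0 : ℝ) 1, (σ t).PosDef) :
    AffineCurve d where
  M := ext01 m
  M₁ := ext01 (derivWithin m (Icc 0 1))
  M₂ := ext01 (derivWithin (derivWithin m (Icc 0 1)) (Icc 0 1))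
  S t := diagVec d (ext01 σ t)
  S₁ t := diagVec d (ext01 (derivWithin σ (Icc 0 1)) t)
  S₂ t := diagVec d (ext01 (derivWithin (derivWithin σ (Icc 0 1)) (Icc 0 1)) t)
  contM := continuous_ext01 hm.continuousOn
  contM₁ := continuous_ext01
    (hm.derivWithin (m := 1) (uniqueDiffOn_Icc zero_lt_one) (by norm_num)).continuousOn
  contM₂ := continuous_ext01 ((hm.derivWithin (m := 1) (uniqueDiffOn_Icc zero_lt_one)
    (by norm_num)).continuousOn_derivWithin (uniqueDiffOn_Icc zero_lt_one) le_rfl)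
  contS := (diagVec d).continuous.comp (continuous_ext01 hσ.continuousOn)
  contS₁ := (diagVec d).continuous.comp (continuous_ext01
    (hσ.derivWithin (m := 1) (uniqueDiffOn_Icc zero_lt_one) (by norm_num)).continuousOn)
  contS₂ := (diagVec d).continuous.comp (continuous_ext01
    ((hσ.derivWithin (m := 1) (uniqueDiffOn_Icc zero_lt_one)
      (by norm_num)).continuousOn_derivWithin (uniqueDiffOn_Icc zero_lt_one) le_rfl))
  derivM _ ht := hasDerivAt_ext01 (hm.differentiableOn (by norm_num)) ht
  derivM₁ _ ht := hasDerivAt_ext01 ((hm.derivWithin (m := 1) (uniqueDiffOn_Icc zero_lt_one)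
    (by norm_num)).differentiableOn (by norm_num)) ht
  derivS t ht := (diagVec d).hasFDerivAt.comp_hasDerivAt t
    (hasDerivAt_ext01 (hσ.differentiableOn (by norm_num)) ht)
  derivS₁ t ht := (diagVec d).hasFDerivAt.comp_hasDerivAt t
    (hasDerivAt_ext01 ((hσ.derivWithin (m := 1) (uniqueDiffOn_Icc zero_lt_one)
      (by norm_num)).differentiableOn (by norm_num)) ht)
  pos t i := by
    -- The extension only takes values that `σ` takes on `[0,1]`, so positivity holds at every real
    -- time.
    obtain ⟨s, hs, h⟩ := ext01_mem σ t
    rw [h, diagVec_apply]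
    exact (hpos s hs).diag_pos

end Diagonal

end WassersteinSpline

theorem mainTheorem3 (d : ℕ) (m : ℝ → EuclideanSpace ℝ (Fin d))
    (σ : ℝ → Matrix (Fin d) (Fin d) ℝ)
    (hm : ContDiffOn ℝ 3 m (Set.Icc 0 1)) (hσ : ContDiffOn ℝ 3 σ (Set.Icc 0 1))
    (hdiag : ∀ t ∈ Set.Icc (0 : ℝ) 1, (σ t).IsDiag)
    (hpos : ∀ t ∈ Set.Icc (0 : ℝ) 1, (σ t).PosDef) :
    WassersteinSpline.pathEnergy
        (fun t => ProbabilityTheory.multivariateGaussian (m t) (σ t ^ 2)) =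
      ENNReal.ofReal ((∫ t in (0 : ℝ)..1, ‖derivWithin σ (Set.Icc 0 1) t‖ ^ 2)
        + ∫ t in (0 : ℝ)..1, ‖derivWithin m (Set.Icc 0 1) t‖ ^ 2) ∧
    WassersteinSpline.splineEnergy
        (fun t => ProbabilityTheory.multivariateGaussian (m t) (σ t ^ 2)) =
      ENNReal.ofReal ((∫ t in (0 : ℝ)..1, ‖iteratedDerivWithin 2 σ (Set.Icc 0 1) t‖ ^ 2)
        + ∫ t in (0 : ℝ)..1, ‖iteratedDerivWithin 2 m (Set.Icc 0 1) t‖ ^ 2) := by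
  open WassersteinSpline Topology in
  have hm2 : ContDiffOn ℝ 2 m (Icc 0 1) := hm.of_le (by norm_num)
  have hσ2 : ContDiffOn ℝ 2 σ (Icc 0 1) := hσ.of_le (by norm_num)
  let c := gaussianCurve hm2 hσ2 hpos
  have hlaw : ∀ t ∈ Ioo (0 : ℝ) 1,
      ProbabilityTheory.multivariateGaussian (m t) (σ t ^ 2) = c.law t := by
    intro t ht
    have ht' := Ioo_subset_Icc_self ht
    rw [multivariateGaussian_sq_of_isDiag _ (hdiag t ht') (hpos t ht'), AffineCurve.law]
    congr 1
    ext1 z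
    simp only [c, AffineCurve.flow, gaussianCurve, ext01_of_mem _ ht']
  have hd0 (t : ℝ) : (ext01 σ t).IsDiag := by
    obtain ⟨s, hs, h⟩ := ext01_mem σ t
    rw [h]
    exact hdiag s hs
  -- Diagonality passes from `σ` to its first and then its second derivative, because each time it
  -- holds on a whole neighbourhood of `t`.
  have hd1 : ∀ t ∈ Ioo (0 : ℝ) 1, (ext01 (derivWithin σ (Icc 0 1)) t).IsDiag := fun t ht =>
    isDiag_of_hasDerivAt (hasDerivAt_ext01 (hσ2.differentiableOn (by norm_num)) ht)
      (Filter.Eventually.of_forall hd0)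
  have hd2 : ∀ t ∈ Ioo (0 : ℝ) 1,
      (ext01 (derivWithin (derivWithin σ (Icc 0 1)) (Icc 0 1)) t).IsDiag := fun t ht =>
    isDiag_of_hasDerivAt (hasDerivAt_ext01 ((hσ2.derivWithin (m := 1)
      (uniqueDiffOn_Icc zero_lt_one) (by norm_num)).differentiableOn (by norm_num)) ht)
      (Filter.mem_of_superset (Ioo_mem_nhds ht.1 ht.2) hd1)
  rw [pathEnergy_congr hlaw, splineEnergy_congr hlaw, iteratedDerivWithin_two,
    iteratedDerivWithin_two, c.pathEnergy_law, c.splineEnergy_law,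
    actionIntegral_affine c c.contM₁ c.contS₁ c.continuous_vel c.vel_flow,
    actionIntegral_affine c c.contM₂ c.contS₂ c.continuous_acc c.acc_flow]
  simp only [c, gaussianCurve]
  rw [integral_norm_sq_diagVec hd1, integral_norm_sq_diagVec hd2]
  refine ⟨?_, ?_⟩
  · rw [integral_ext01, integral_ext01]
  · rw [integral_ext01, integral_ext01]
    rfl
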